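/- Let $\mathbf k$ be an algebraically closed field of characteristic zero, let $1\le p<n$ be integers with $p$ coprime to $n$, and let $\mathfrak g=\mathfrak{sl}_n(\mathbf k)$ with simple roots $\pi=\{\alpha_1,\dots,\alpha_{n-1}\}$, $\alpha_l=\varepsilon_l-\varepsilon_{l+1}$, and root vectors $x_{\varepsilon_i-\varepsilon_j}$ the matrix units $x_{i,j}$. Put $\pi^+=\pi$ and $\pi^-=\pi\setminus\{\alpha_p\}$. Let $\mathfrak q\subset\mathfrak g$ be the standard parabolic subalgebra whose roots are the negative roots together with the roots in $\mathbb Z\pi^-$ (the biparabolic of type $(\pi^+,\pi^-)$), and let $\mathfrak q_\Lambda$ be its canonical truncation, that is, the common kernel of the weights of all semi-invariants of the adjoint action of $\mathfrak q$ on $S(\mathfrak q)$. (These are the truncated biparabolics of index one.) Let $\rho:\mathfrak g^*\to\mathfrak q_\Lambda^*$ be the restriction map; elements of $\mathfrak g$ are viewed in $\mathfrak g^*$, and by restriction in $\mathfrak q_\Lambda^*$, through the Killing form. Let $\mathscr N(\mathfrak g)_{reg}\subset\mathfrak g^*$ be the set of common zeros of the homogeneous invariants of positive degree in $S(\mathfrak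 g)$ whose coadjoint stabilizer has the minimal possible dimension. Let $\mathscr K=\{\varepsilon_i-\varepsilon_{n+1-i}: i<n+1-i\}$ and $\mathscr K'=\{\varepsilon_i-\varepsilon_{p+1-i}: 1\le i<p+1-i\}\cup\{\varepsilon_i-\varepsilon_{n+p+1-i}: p<i<n+p+1-i\}$ be the Kostant cascades of $\pi$ and $\pi^-$. Then exactly one root of $\mathscr K\cup(-\mathscr K')$ lies in $\pi\cup(-\pi)$. Denote it by $\epsilon_s\beta_s$, let $\eta$ be the sum of the $x_\gamma$ over all other $\gamma\in\mathscr K\cup(-\mathscr K')$, and let $\mathscr W=\eta+\mathbf k\,x_{\epsilon_s\beta_s}\subset\mathfrak q_\Lambda^*$ (the Weierstrass section). There is a (Zariski closed) one-dimensional subvariety $Z$ of $\mathscr N(\mathfrak g)_{reg}$ which $\rho$ maps bijectively onto $\mathscr W$, and such that: - if $p\ne 1$ and $p\neq n-1$, then $Z$ is irreducible; - if $p=1$ or $p=n-1$, then $Z=C\cup\{z\}$, where $C$ is an irreducible (closed) one-dimensional subvariety of $\mathscr N(\mathfrak g)_{reg}$ and $z\notin C$ is a point. -/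

import Mathlib

noncomputable section

namespace IndexOne

open LieAlgebra.SpecialLinear

section General

variable (k : Type*) [Field k] (a : Type*) [LieRing a] [LieAlgebra k a]

/-! ### The symmetric algebra `S(a)`, viewed as the polynomial functions on `a*` -/

/-- The value of the polynomial function `F ∈ S(a)` at the point `f ∈ a*`. -/
def evalAt (f : Module.Dual k a) : SymmetricAlgebra k a →ₐ[k] k :=
  SymmetricAlgebra.lift f

/-- The algebra map `S(a) → S(a)[ε]` with `x ↦ x + ε [u, x]` for `x ∈ a`; its `ε`-component is
the adjoint action of `u` on `S(a)`. -/
def adDual (u : a) : SymmetricAlgebra k a →ₐ[k] DualNumber (SymmetricAlgebra k a) :=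
  SymmetricAlgebra.lift
    ((TrivSqZeroExt.inlAlgHom k (SymmetricAlgebra k a) (SymmetricAlgebra k a)).toLinearMap ∘ₗ
        SymmetricAlgebra.ι k a +
      (TrivSqZeroExt.inrHom (SymmetricAlgebra k a) (SymmetricAlgebra k a)).restrictScalars k ∘ₗ
        SymmetricAlgebra.ι k a ∘ₗ LieAlgebra.ad k a u)

theorem fst_adDual (u : a) (F : SymmetricAlgebra k a) : (adDual k a u F).fst = F := by
  have h : (TrivSqZeroExt.fstHom k (SymmetricAlgebra k a) (SymmetricAlgebra k a)).comp
      (adDual k a u) = AlgHom.id k _ := by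
    apply SymmetricAlgebra.algHom_ext
    ext x
    simp [adDual]
  exact DFunLike.congr_fun h F

/-- The adjoint action of `u ∈ a` on `S(a)`: the derivation of `S(a)` extending `ad u`. -/
def adS (u : a) : Derivation k (SymmetricAlgebra k a) (SymmetricAlgebra k a) where
  toLinearMap := (TrivSqZeroExt.sndHom (SymmetricAlgebra k a)
    (SymmetricAlgebra k a)).restrictScalars k ∘ₗ (adDual k a u).toLinearMap
  map_one_eq_zero' := by simp
  leibniz' F G := by simp [fst_adDual, mul_comm G]

theorem adS_ι (u x : a) :
    adS k a u (SymmetricAlgebra.ι k a x) = SymmetricAlgebra.ι k a ⁅u, x⁆ := by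
  change (adDual k a u (SymmetricAlgebra.ι k a x)).snd = _
  simp [adDual]

theorem adS_lie (u v : a) (F : SymmetricAlgebra k a) :
    adS k a ⁅u, v⁆ F = adS k a u (adS k a v F) - adS k a v (adS k a u F) := by
  induction F using SymmetricAlgebra.induction with
  | algebraMap r => simp
  | ι x => simp [adS_ι, ← map_sub]
  | mul F G hF hG => simp [hF, hG]; ring
  | add F G hF hG => simp [hF, hG]; ring

/-- `Y(a)`: the invariants of `S(a)` under the adjoint action, that is, the invariant polynomial
functions on `a*`. -/
def invariants : Subalgebra k (SymmetricAlgebra k a) where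
  carrier := {F | ∀ u : a, adS k a u F = 0}
  mul_mem' hF hG u := by simp [hF u, hG u]
  add_mem' hF hG u := by simp [hF u, hG u]
  algebraMap_mem' r u := by simp

/-- The homogeneous component of degree `d` of `S(a)`. -/
def homogeneous (d : ℕ) : Submodule k (SymmetricAlgebra k a) :=
  LinearMap.range (SymmetricAlgebra.ι k a) ^ d

/-- The nullcone `N(a) ⊆ a*`: the zero locus of the homogeneous invariants of positive degree. -/
def nullcone : Set (Module.Dual k a) :=
  {f | ∀ d : ℕ, 0 < d → ∀ F ∈ invariants k a, F ∈ homogeneous k a d → evalAt k a f F = 0}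

/-- The stabilizer `a^f` of `f ∈ a*` for the coadjoint action. -/
def stabilizer (f : Module.Dual k a) : Submodule k a where
  carrier := {u | ∀ v : a, f ⁅u, v⁆ = 0}
  add_mem' hu hv w := by simp [hu w, hv w]
  zero_mem' w := by simp
  smul_mem' c u hu w := by simp [hu w]

/-- The regular elements of `a*`: those whose stabilizer has the minimal dimension. -/
def regularSet : Set (Module.Dual k a) :=
  {f | ∀ g : Module.Dual k a,
    Module.finrank k (stabilizer k a f) ≤ Module.finrank k (stabilizer k a g)}

/-- `N(a)_reg`. -/
def regNullcone : Set (Module.Dual k a) :=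
  nullcone k a ∩ regularSet k a

/-- `F` is a semi-invariant of `S(a)` of weight `χ`. -/
def IsSemiInvariant (χ : Module.Dual k a) (F : SymmetricAlgebra k a) : Prop :=
  F ≠ 0 ∧ ∀ u : a, adS k a u F = χ u • F

/-- The canonical truncation `a_Λ`: the common kernel of the weights of the semi-invariants
of `S(a)`. -/
def truncation : LieIdeal k a where
  carrier := {u | ∀ χ F, IsSemiInvariant k a χ F → χ u = 0}
  add_mem' hu hv χ F h := by simp [hu χ F h, hv χ F h]
  zero_mem' χ F _ := by simp
  smul_mem' c u hu χ F h := by simp [hu χ F h]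
  lie_mem := by
    intro u v _ χ F h
    have h1 := adS_lie k a u v F
    simp only [h.2, Derivation.map_smul, smul_smul, mul_comm (χ v), sub_self] at h1
    exact (smul_eq_zero.mp h1).resolve_right h.1

/-! ### The Zariski topology on `a*` -/

/-- The Zariski topology on the affine space `a*`, with basis the non-vanishing loci of
polynomial functions. -/
@[reducible] def zariski : TopologicalSpace (Module.Dual k a) :=
  TopologicalSpace.generateFrom {U | ∃ F : SymmetricAlgebra k a, U = {f | evalAt k a f F ≠ 0}}

/-- `Z` is a closed subvariety of the subset `X` of `a*`. -/
def IsSubvariety (X Z : Set (Module.Dual k a)) : Prop :=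
  ∃ T : Set (Module.Dual k a), @IsClosed _ (zariski k a) T ∧ Z = T ∩ X

/-- `Z` is irreducible (in particular non-empty). -/
def IsIrred (Z : Set (Module.Dual k a)) : Prop :=
  @IsIrreducible _ (zariski k a) Z

/-- The dimension of `Z` with its induced Zariski topology. -/
def dimension (Z : Set (Module.Dual k a)) : WithBot ℕ∞ :=
  @topologicalKrullDim Z (TopologicalSpace.induced Subtype.val (zariski k a))

end General

/-! ### Roots, cascades and biparabolics of `sl_n`

The indices `1, …, n` are represented by `Fin n`, shifted by one. The root `ε_i - ε_j` is the
pair `(i, j)` with `i ≠ j`. A set of simple roots is represented by the set of its labels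
`l ∈ {1, …, n - 1}`, where `α_l = ε_l - ε_{l+1}` in the usual numbering from `1` to `n`; thus
`ε_i - ε_j` with `i < j` in `Fin n` has support `{α_l : i < l ≤ j}`. -/

/-- The set `π` of all simple roots. -/
def simpleRoots (n : ℕ) : Set ℕ := Set.Ico 1 n

section Roots

variable {n : ℕ}

/-- The positive root `ε_i - ε_j` (`i < j`) belongs to `ℕ π'`. -/
def SupportedIn (π' : Set ℕ) (i j : Fin n) : Prop :=
  ∀ l : ℕ, (i : ℕ) < l → l ≤ (j : ℕ) → l ∈ π'

/-- `[r, s]` is a connected component of the partition of the indices defined by `π'`. -/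
def IsComponent (π' : Set ℕ) (r s : Fin n) : Prop :=
  r ≤ s ∧ SupportedIn π' r s ∧ (r : ℕ) ∉ π' ∧ (s : ℕ) + 1 ∉ π'

/-- The Kostant cascade of `π'`: the positive roots `ε_i - ε_j` where `i` and `j` are exchanged by
the reflection in the centre of a connected component. -/
def cascade (π' : Set ℕ) : Set (Fin n × Fin n) :=
  {γ | γ.1 < γ.2 ∧ ∃ r s : Fin n, IsComponent π' r s ∧ r ≤ γ.1 ∧ γ.2 ≤ s ∧
    (γ.1 : ℕ) + (γ.2 : ℕ) = (r : ℕ) + (s : ℕ)}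

/-- `𝒦 ∪ (-𝒦')`, where `𝒦` is the cascade of `πp` and `𝒦'` that of `πm`. -/
def cascadeRoots (πp πm : Set ℕ) : Set (Fin n × Fin n) :=
  cascade πp ∪ {γ | (γ.2, γ.1) ∈ cascade πm}

/-- The root `ε_i - ε_j` is in `π ∪ (-π)`. -/
def IsSimpleUpToSign (γ : Fin n × Fin n) : Prop :=
  (γ.1 : ℕ) + 1 = γ.2 ∨ (γ.2 : ℕ) + 1 = γ.1

/-- The exceptional value: a root of `π ∪ (-π)` lying in `𝒦 ∪ (-𝒦')`. -/
def IsExceptional (πp πm : Set ℕ) (γ : Fin n × Fin n) : Prop :=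
  γ ∈ cascadeRoots πp πm ∧ IsSimpleUpToSign γ

end Roots

section SpecialLinear

variable (k : Type*) [Field k] (n : ℕ)

/-- The subalgebra of `sl_n` of the matrices supported on a transitive relation. -/
def supportedSubalgebra (r : Fin n → Fin n → Prop)
    (htrans : ∀ i j l, r i j → r j l → r i l) : LieSubalgebra k (sl (Fin n) k) where
  carrier := {x | ∀ i j, ¬ r i j → x.val i j = 0}
  add_mem' hx hy i j h := by simp [hx i j h, hy i j h]
  zero_mem' i j _ := by simp
  smul_mem' c x hx i j h := by simp [hx i j h]
  lie_mem' := by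
    intro x y hx hy i j h
    have key : ∀ u v : Matrix (Fin n) (Fin n) k, (∀ i j, ¬ r i j → u i j = 0) →
        (∀ i j, ¬ r i j → v i j = 0) → (u * v) i j = 0 := by
      intro u v hu hv
      rw [Matrix.mul_apply]
      refine Finset.sum_eq_zero fun l _ => ?_
      by_cases h1 : r i l
      · rw [hv l j fun h2 => h (htrans i l j h1 h2), mul_zero]
      · rw [hu i l h1, zero_mul]
    rw [sl_bracket, Matrix.sub_apply, key _ _ hx hy, key _ _ hy hx, sub_zero]

/-- The standard parabolic `p⁻_{π'}`, with set of roots `Δ⁻ ∪ (Δ ∩ ℤ π')`. -/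
def negParabolic (π' : Set ℕ) : LieSubalgebra k (sl (Fin n) k) :=
  supportedSubalgebra k n (fun i j => j ≤ i ∨ SupportedIn π' i j) <| by
    intro i j l h1 h2
    by_cases h : l ≤ i
    · exact Or.inl h
    refine Or.inr fun t ht1 ht2 => ?_
    rw [Fin.le_def] at h h1 h2
    by_cases h3 : t ≤ (j : ℕ)
    · exact (h1.resolve_left (by omega)) t ht1 h3
    · exact (h2.resolve_left (by omega)) t (by omega) ht2

/-- The standard parabolic `p⁺_{π'}`, with set of roots `Δ⁺ ∪ (Δ ∩ ℤ π')`. -/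
def posParabolic (π' : Set ℕ) : LieSubalgebra k (sl (Fin n) k) :=
  supportedSubalgebra k n (fun i j => i ≤ j ∨ SupportedIn π' j i) <| by
    intro i j l h1 h2
    by_cases h : i ≤ l
    · exact Or.inl h
    refine Or.inr fun t ht1 ht2 => ?_
    rw [Fin.le_def] at h h1 h2
    by_cases h3 : t ≤ (j : ℕ)
    · exact (h2.resolve_left (by omega)) t ht1 h3
    · exact (h1.resolve_left (by omega)) t (by omega) ht2

/-- The biparabolic subalgebra `q` of type `(π⁺, π⁻) = (πp, πm)`, namely `p⁻_{π⁻} ∩ p⁺_{π⁺}`. Its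
dual is identified by the Killing form with the opposed subalgebra, whose roots are
`Δ ∩ (ℕ π⁺ ∪ -ℕ π⁻)`. -/
def biparabolic (πp πm : Set ℕ) : LieSubalgebra k (sl (Fin n) k) :=
  negParabolic k n πm ⊓ posParabolic k n πp

/-- The canonical truncation `q_Λ` of the biparabolic `q` of type `(π⁺, π⁻) = (πp, πm)`. -/
abbrev truncatedBiparabolic (πp πm : Set ℕ) : LieIdeal k (biparabolic k n πp πm) :=
  truncation k (biparabolic k n πp πm)

/-- The restriction map `ρ : g* → q_Λ*`. -/
def restriction (πp πm : Set ℕ) :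
    Module.Dual k (sl (Fin n) k) →ₗ[k] Module.Dual k (truncatedBiparabolic k n πp πm) :=
  Module.Dual.transpose ((biparabolic k n πp πm).toSubmodule.subtype ∘ₗ
    (truncatedBiparabolic k n πp πm).toSubmodule.subtype)

variable {n}

/-- The root vector `x_γ` of `sl_n`: the matrix unit `x_{i,j}` for `γ = ε_i - ε_j`. -/
def rootVector (γ : Fin n × Fin n) : sl (Fin n) k :=
  if h : γ.1 ≠ γ.2 then single γ.1 γ.2 h 1 else 0

open Classical in
/-- The element `Σ x_δ` of `sl_n`, the sum being over the `δ` in `𝒦 ∪ (-𝒦')` other than `γ`. -/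
def eta (πp πm : Set ℕ) (γ : Fin n × Fin n) : sl (Fin n) k :=
  ∑ δ : Fin n × Fin n with δ ∈ cascadeRoots πp πm ∧ δ ≠ γ, rootVector k δ

/-- The line `𝒲 = η + k x_γ` in `q_Λ*`, where elements of `sl_n` define linear forms on `q_Λ`
through the Killing form. -/
def weierstrassLine (πp πm : Set ℕ) (γ : Fin n × Fin n) :
    Set (Module.Dual k (truncatedBiparabolic k n πp πm)) :=
  Set.range fun c : k =>
    restriction k n πp πm (killingForm k (sl (Fin n) k) (eta k πp πm γ + c • rootVector k γ))

end SpecialLinear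

end IndexOne

end

/-! A matrix unit `x_{i,j}` with `i` in the second block of indices and `j` in the first is
orthogonal to `q` for the Killing form, so such entries can be added to `η + c x_γ` without changing
its image under `ρ`. The point is to choose them so that the result is regular nilpotent. This holds
as soon as the matrix is strictly triangular for some total order of the indices and has no zero
entry at two successive indices (`IsTriangularFor.mem_regNullcone`).

The roots of `𝒦 ∪ (-𝒦')` are the arrows of a graph on the indices which, forgetting orientations, is
a path when `p` and `n` are coprime (`exists_path_numbering`). If both blocks have size at least
two, there is a total order for which every arrow increases and any two successive indices are
either joined by an arrow other than `γ` or go from the second block to the first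
(`exists_isAdapted`). Adding the matrix units of the second kind (`link`) gives a regular nilpotent
element for every `c`, and `Z` is an affine line.

If a block has size one, the arrows follow the path in one direction and `γ` is an end arrow
(`exists_isOrientedPath`). Then `η + c x_γ` is itself regular nilpotent exactly for `c ≠ 0`, which
gives a punctured line `C`, closed in the regular nullcone because its missing point is not regular.
Over `c = 0` a link for a second order, with the end vertex moved to the other end, supplies the
extra point `z`.

Bijectivity onto the section comes from reading off `c` on the root vector opposed to `γ`, which
lies in the truncation (`weierstrass_injective`). -/

noncomputable section

namespace IndexOne

open LieAlgebra.SpecialLinear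

/-! ### The Killing form of `sl_n` and coadjoint stabilizers. -/

section Killing

variable {k : Type*} [Field k] {n : ℕ}

theorem trace_sl (x : sl (Fin n) k) : x.val.trace = 0 := x.2

theorem val_add_apply (x y : sl (Fin n) k) (i j : Fin n) :
    (x + y).val i j = x.val i j + y.val i j := rfl

theorem val_smul_apply (c : k) (x : sl (Fin n) k) (i j : Fin n) :
    (c • x).val i j = c * x.val i j := rfl

/-- The trace of `E ↦ a E b` on square matrices is `tr a · tr b`. -/
theorem trace_mulLeft_mulRight (a b : Matrix (Fin n) (Fin n) k) :
    LinearMap.trace k (Matrix (Fin n) (Fin n) k)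
      (LinearMap.mulLeft k a ∘ₗ LinearMap.mulRight k b) = a.trace * b.trace := by
  rw [LinearMap.trace_eq_matrix_trace k (Matrix.stdBasis k (Fin n) (Fin n)), Matrix.trace,
    Fintype.sum_prod_type, Matrix.trace, Matrix.trace, Finset.sum_mul_sum]
  refine Finset.sum_congr rfl fun i _ => Finset.sum_congr rfl fun j _ => ?_
  rw [Matrix.diag_apply, LinearMap.toMatrix_apply, Matrix.stdBasis_eq_single]
  simp [Matrix.stdBasis, Matrix.mul_apply, Matrix.single_apply, ite_and]

/-- The operator `ad x ∘ ad y` extends to all matrices with image in the traceless ones, so the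
extension has the same trace. Expanding it into left and right multiplications, the two mixed terms
vanish because `x` and `y` are traceless, and each remaining term contributes `n * tr (x y)`. -/
theorem killingForm_sl (x y : sl (Fin n) k) :
    killingForm k (sl (Fin n) k) x y = 2 * n * (x.val * y.val).trace := by
  let L := LinearMap.mulLeft k (A := Matrix (Fin n) (Fin n) k)
  let R := LinearMap.mulRight k (A := Matrix (Fin n) (Fin n) k)
  let φ : Module.End k (Matrix (Fin n) (Fin n) k) :=
    L (x.val * y.val) ∘ₗ R 1 - L x.val ∘ₗ R y.val - L y.val ∘ₗ R x.val + L 1 ∘ₗ R (y.val * x.val)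
  have hφ : ∀ z, φ z = x.val * (y.val * z - z * y.val) - (y.val * z - z * y.val) * x.val := by
    intro z
    simp only [φ, L, R, LinearMap.add_apply, LinearMap.sub_apply, LinearMap.comp_apply,
      LinearMap.mulLeft_apply, LinearMap.mulRight_apply]
    noncomm_ring
  let K : Submodule k (Matrix (Fin n) (Fin n) k) :=
    LinearMap.ker (Matrix.traceLinearMap (Fin n) k k)
  have hmem : ∀ z, φ z ∈ K := by
    intro z
    change Matrix.trace (φ z) = 0
    rw [hφ, Matrix.trace_sub, Matrix.trace_mul_comm, sub_self]
  have h1 := LinearMap.trace_restrict_eq_of_forall_mem K φ hmem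
  have h2 : killingForm k (sl (Fin n) k) x y =
      LinearMap.trace k K (φ.restrict (p := K) (q := K) fun z _ => hmem z) := by
    rw [killingForm_apply_apply]
    exact congrArg (LinearMap.trace k K) (LinearMap.ext fun z => Subtype.ext (hφ z).symm)
  rw [h2, h1]
  simp only [φ, L, R, map_add, map_sub, trace_mulLeft_mulRight, trace_sl, Matrix.trace_one,
    Fintype.card_fin, Matrix.trace_mul_comm y.val]
  ring

variable [CharZero k]

theorem killingForm_sl_injective (hn : n ≠ 0) :
    Function.Injective (killingForm k (sl (Fin n) k)) := by
  rw [injective_iff_map_eq_zero]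
  intro x hx
  have hn' : (n : k) ≠ 0 := Nat.cast_ne_zero.mpr hn
  have h : ∀ y : sl (Fin n) k, (x.val * y.val).trace = 0 := by
    intro y
    have := LinearMap.congr_fun hx y
    rw [killingForm_sl] at this
    simpa [hn'] using this
  have hoff : ∀ i j, i ≠ j → x.val i j = 0 := by
    intro i j hij
    have := h (single j i hij.symm 1)
    simpa [Matrix.trace_mul_single] using this
  have hdiag : ∀ i j, x.val i i = x.val j j := by
    intro i j
    have := h (singleSubSingle i j 1)
    rw [val_singleSubSingle, mul_sub, Matrix.trace_sub] at this
    simpa [Matrix.trace_mul_single, sub_eq_zero] using this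
  have hz : ∀ i, x.val i i = 0 := by
    intro i
    have h0 := trace_sl x
    simp only [Matrix.trace, Matrix.diag_apply, fun j => hdiag j i, Finset.sum_const,
      Finset.card_univ, Fintype.card_fin, nsmul_eq_mul, mul_eq_zero, hn', false_or] at h0
    exact h0
  ext i j
  by_cases hij : i = j
  · subst hij; exact hz i
  · exact hoff i j hij

theorem killingForm_sl_surjective (hn : n ≠ 0) :
    Function.Surjective (killingForm k (sl (Fin n) k)) :=
  (LinearMap.injective_iff_surjective_of_finrank_eq_finrank
    (Subspace.dual_finrank_eq (K := k) (V := sl (Fin n) k)).symm).mp (killingForm_sl_injective hn)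

theorem mem_stabilizer_killingForm (hn : n ≠ 0) (x u : sl (Fin n) k) :
    u ∈ stabilizer k (sl (Fin n) k) (killingForm k (sl (Fin n) k) x) ↔
      x.val * u.val = u.val * x.val := by
  have h1 : u ∈ stabilizer k (sl (Fin n) k) (killingForm k (sl (Fin n) k) x) ↔
      killingForm k (sl (Fin n) k) ⁅x, u⁆ = 0 := by
    constructor
    · intro h
      ext v
      have : killingForm k (sl (Fin n) k) ⁅x, u⁆ v = killingForm k (sl (Fin n) k) x ⁅u, v⁆ :=
        LieModule.traceForm_apply_lie_apply k _ _ x u v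
      rw [this, h v]; rfl
    · intro h v
      have : killingForm k (sl (Fin n) k) ⁅x, u⁆ v = killingForm k (sl (Fin n) k) x ⁅u, v⁆ :=
        LieModule.traceForm_apply_lie_apply k _ _ x u v
      rw [← this, h]; rfl
  rw [h1, (injective_iff_map_eq_zero' _).mp (killingForm_sl_injective hn), Subtype.ext_iff,
    sl_bracket, ZeroMemClass.coe_zero, sub_eq_zero]

end Killing

/-! ### Strictly triangular matrices lie in the nullcone. -/

section Nullcone

variable {k : Type*} [Field k] {n : ℕ}

theorem algebraMapInv_eq_zero_of_mem_homogeneous {a : Type*} [LieRing a] [LieAlgebra k a] {d : ℕ}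
    (hd : 0 < d) {F : SymmetricAlgebra k a} (hF : F ∈ homogeneous k a d) :
    SymmetricAlgebra.algebraMapInv F = (0 : k) := by
  obtain ⟨d, rfl⟩ : ∃ e, d = e + 1 := ⟨d - 1, by omega⟩
  rw [homogeneous, pow_succ] at hF
  induction hF using Submodule.mul_induction_on' with
  | mem_mul_mem x hx y hy =>
    obtain ⟨y, rfl⟩ := hy
    rw [map_mul, SymmetricAlgebra.algebraMapInv_ι, mul_zero]
  | add x hx y hy h1 h2 => rw [map_add, h1, h2, add_zero]

variable (k) in
/-- The diagonal matrix with entries `w`, made traceless. -/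
def diagTraceless [CharZero k] (w : Fin n → ℕ) : sl (Fin n) k :=
  ⟨Matrix.diagonal (fun i => (w i : k) - (∑ j, (w j : k)) / n), by
    change Matrix.trace (Matrix.diagonal (fun i => (w i : k) - (∑ j, (w j : k)) / n)) = 0
    rcases eq_or_ne n 0 with rfl | hn
    · simp
    · have hn' : (n : k) ≠ 0 := Nat.cast_ne_zero.mpr hn
      rw [Matrix.trace_diagonal, Finset.sum_sub_distrib, Finset.sum_const, Finset.card_univ,
        Fintype.card_fin, nsmul_eq_mul, mul_div_cancel₀ _ hn', sub_self]⟩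

theorem lie_diagTraceless_apply [CharZero k] (w : Fin n → ℕ) (y : sl (Fin n) k) (i j : Fin n) :
    (⁅diagTraceless k w, y⁆ : sl (Fin n) k).val i j = ((w i : k) - w j) * y.val i j := by
  rw [sl_bracket, Matrix.sub_apply, diagTraceless, Matrix.diagonal_mul, Matrix.mul_diagonal]
  ring

/-- The rescaling of the linear form defined by `x` along the weights `w`. -/
def scaledForm (x : sl (Fin n) k) (w : Fin n → ℕ) : sl (Fin n) k →ₗ[k] Polynomial k where
  toFun y := ∑ i, ∑ j, Polynomial.monomial (w j - w i) (2 * n * (x.val i j * y.val j i))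
  map_add' y z := by
    simp only [← Finset.sum_add_distrib, ← map_add]
    refine Finset.sum_congr rfl fun i _ => Finset.sum_congr rfl fun j _ => ?_
    congr 1
    rw [val_add_apply]
    ring
  map_smul' c y := by
    simp only [Finset.smul_sum, Polynomial.smul_monomial, RingHom.id_apply]
    refine Finset.sum_congr rfl fun i _ => Finset.sum_congr rfl fun j _ => ?_
    congr 1
    rw [val_smul_apply, smul_eq_mul]
    ring

theorem eval_one_scaledForm (x : sl (Fin n) k) (w : Fin n → ℕ) (y : sl (Fin n) k) :
    (scaledForm x w y).eval 1 = killingForm k (sl (Fin n) k) x y := by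
  simp [scaledForm, Polynomial.eval_finsetSum, killingForm_sl, Matrix.trace, Matrix.mul_apply,
    Finset.mul_sum]

variable {x : sl (Fin n) k} {w : Fin n → ℕ}

theorem eval_zero_scaledForm (hx : ∀ i j, x.val i j ≠ 0 → w i < w j) (y : sl (Fin n) k) :
    (scaledForm x w y).eval 0 = 0 := by
  simp only [scaledForm, LinearMap.coe_mk, AddHom.coe_mk, Polynomial.eval_finsetSum]
  refine Finset.sum_eq_zero fun i _ => Finset.sum_eq_zero fun j _ => ?_
  by_cases h : x.val i j = 0
  · simp [h]
  · have := hx i j h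
    simp [Polynomial.eval_monomial, show w j - w i ≠ 0 by omega]

variable [CharZero k]

theorem scaledForm_lie (hx : ∀ i j, x.val i j ≠ 0 → w i < w j) (y : sl (Fin n) k) :
    scaledForm x w ⁅diagTraceless k w, y⁆ =
      Polynomial.X * Polynomial.derivative (scaledForm x w y) := by
  simp only [scaledForm, LinearMap.coe_mk, AddHom.coe_mk, Polynomial.derivative_sum,
    Finset.mul_sum, Polynomial.derivative_monomial, lie_diagTraceless_apply]
  refine Finset.sum_congr rfl fun i _ => Finset.sum_congr rfl fun j _ => ?_
  by_cases h : x.val i j = 0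
  · simp [h]
  · have := hx i j h
    rw [Polynomial.X_mul_monomial, Nat.sub_add_cancel (by omega), Nat.cast_sub this.le]
    congr 1
    ring

/-- The Euler operator `t d/dt` on the rescaled form is the infinitesimal action of the diagonal
matrix of weights. Both sides obey the same Leibniz rule, so generators suffice. -/
theorem lift_scaledForm_adS (hx : ∀ i j, x.val i j ≠ 0 → w i < w j)
    (F : SymmetricAlgebra k (sl (Fin n) k)) :
    SymmetricAlgebra.lift (scaledForm x w) (adS k _ (diagTraceless k w) F) =
      Polynomial.X * Polynomial.derivative (SymmetricAlgebra.lift (scaledForm x w) F) := by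
  induction F using SymmetricAlgebra.induction with
  | algebraMap r => simp
  | ι y => rw [adS_ι, SymmetricAlgebra.lift_ι_apply, SymmetricAlgebra.lift_ι_apply,
      scaledForm_lie hx]
  | mul F G hF hG => 
    rw [Derivation.leibniz, map_add, smul_eq_mul, smul_eq_mul, map_mul, map_mul, hF, hG, map_mul,
      Polynomial.derivative_mul]
    ring
  | add F G hF hG => rw [map_add, map_add, hF, hG, map_add, Polynomial.derivative_add, mul_add]

/-- A matrix that strictly raises a weight function lies in the nullcone. -/
theorem killingForm_mem_nullcone (hx : ∀ i j, x.val i j ≠ 0 → w i < w j) :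
    killingForm k (sl (Fin n) k) x ∈ nullcone k (sl (Fin n) k) := by
  intro d hd F hF hFd
  set P := SymmetricAlgebra.lift (scaledForm x w) F with hP
  -- By invariance and characteristic zero, `F` is constant along the rescaling, which joins the
  -- given form at `t = 1` to the zero form at `t = 0`. There `F` takes the value of its constant
  -- term, which is zero.
  have h0 : Polynomial.X * Polynomial.derivative P = 0 := by
    rw [hP, ← lift_scaledForm_adS hx, hF, map_zero]
  have h1 : Polynomial.derivative P = 0 :=
    (mul_eq_zero.mp h0).resolve_left Polynomial.X_ne_zero
  have h2 := Polynomial.eq_C_of_derivative_eq_zero h1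
  have e1 : P.eval 1 = evalAt k _ (killingForm k (sl (Fin n) k) x) F := by
    have : ((Polynomial.aeval (1 : k)).comp (SymmetricAlgebra.lift (scaledForm x w))) =
        evalAt k _ (killingForm k (sl (Fin n) k) x) := by
      apply SymmetricAlgebra.algHom_ext
      ext y
      simp [evalAt, ← eval_one_scaledForm x w, Polynomial.coe_aeval_eq_eval]
    rw [← this, hP]
    simp [Polynomial.coe_aeval_eq_eval]
  have e0 : P.eval 0 = SymmetricAlgebra.algebraMapInv F := by
    have : ((Polynomial.aeval (0 : k)).comp (SymmetricAlgebra.lift (scaledForm x w))) =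
        SymmetricAlgebra.algebraMapInv := by
      apply SymmetricAlgebra.algHom_ext
      ext y
      simpa [SymmetricAlgebra.algebraMapInv, Polynomial.coe_aeval_eq_eval] using
        eval_zero_scaledForm hx y
    rw [← this, hP]
    simp [Polynomial.coe_aeval_eq_eval]
  rw [← e1, h2, Polynomial.eval_C, Polynomial.coeff_zero_eq_eval_zero, e0,
    algebraMapInv_eq_zero_of_mem_homogeneous hd hFd]

end Nullcone

/-! ### Commutant dimensions and regular nilpotent matrices. -/

section Regular

variable {k : Type*} [Field k] {n : ℕ}

/-- An eigenvector of the transpose is a linear form with stable kernel. The induction applies to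
this hyperplane, and a vector outside it is put first. -/
theorem exists_triangular_basis [IsAlgClosed k] (n : ℕ) (V : Type*) [AddCommGroup V] [Module k V]
    [FiniteDimensional k V] (hV : Module.finrank k V = n) (f : Module.End k V) :
    ∃ b : Module.Basis (Fin n) k V, ∀ i j, i < j → b.repr (f (b j)) i = 0 := by
  induction n generalizing V with
  | zero => exact ⟨Module.finBasisOfFinrankEq k V hV, fun i => i.elim0⟩
  | succ n ih =>
    have hpos : 0 < Module.finrank k (Module.Dual k V) := by
      rw [Subspace.dual_finrank_eq]; omega
    have : Nontrivial (Module.Dual k V) := Module.nontrivial_of_finrank_pos hpos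
    obtain ⟨μ, hμ⟩ := Module.End.exists_eigenvalue (Module.Dual.transpose (R := k) f)
    obtain ⟨φ, hφ⟩ := hμ.exists_hasEigenvector
    have hφf : ∀ v, φ (f v) = μ * φ v := fun v => LinearMap.congr_fun hφ.apply_eq_smul v
    have hφ0 : φ ≠ 0 := hφ.2
    obtain ⟨y, hy⟩ : ∃ y, φ y ≠ 0 := by
      by_contra! h
      exact hφ0 (LinearMap.ext h)
    have hfin : Module.finrank k (LinearMap.ker φ) = n := by
      have h1 := φ.finrank_range_add_finrank_ker
      rw [LinearMap.range_eq_top.mpr (LinearMap.surjective hφ0), finrank_top,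
        Module.finrank_self, hV] at h1
      omega
    have hmaps : ∀ v ∈ LinearMap.ker φ, f v ∈ LinearMap.ker φ := by
      intro v hv
      rw [LinearMap.mem_ker] at hv ⊢
      rw [hφf, hv, mul_zero]
    obtain ⟨b, hb⟩ := ih (LinearMap.ker φ) hfin (f.restrict hmaps)
    let B := Module.Basis.mkFinCons y b
      (fun c x hx h => by
        have := congrArg φ h
        rw [map_add, map_smul, LinearMap.mem_ker.mp hx, add_zero, map_zero, smul_eq_mul] at this
        exact (mul_eq_zero.mp this).resolve_right hy)
      (fun z => ⟨-(φ z / φ y), by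
        rw [LinearMap.mem_ker, map_add, map_smul, smul_eq_mul]
        field_simp
        ring⟩)
    have hBs : ∀ i : Fin n, B i.succ = b i := by simp [B]
    have hrepr : ∀ v : LinearMap.ker φ,
        (B.repr v 0 = 0) ∧ ∀ i : Fin n, B.repr v i.succ = b.repr v i := by
      intro v
      have hv : (v : V) =
          ∑ i, (Fin.cons (0 : k) (fun i => b.repr v i) : Fin (n + 1) → k) i • B i := by
        rw [Fin.sum_univ_succ]
        simp only [Fin.cons_zero, zero_smul, Fin.cons_succ, zero_add, hBs]
        have h := congrArg Subtype.val (b.sum_repr v)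
        rw [AddSubmonoidClass.coe_finsetSum] at h
        exact h.symm
      have h2 := B.repr_sum_self (Fin.cons (0 : k) (fun i => b.repr v i) : Fin (n + 1) → k)
      rw [← hv] at h2
      exact ⟨by rw [h2]; simp, fun i => by rw [h2]; simp⟩
    refine ⟨B, fun i j hij => ?_⟩
    obtain ⟨j, rfl⟩ := Fin.exists_succ_eq.mpr (Fin.ne_zero_of_lt hij)
    have h3 : f (B j.succ) = (f.restrict hmaps (b j) : LinearMap.ker φ) := by rw [hBs]; rfl
    rw [h3]
    refine Fin.cases (fun _ => (hrepr _).1) (fun i hij => ?_) i hij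
    rw [(hrepr _).2]
    exact hb i j (Fin.succ_lt_succ_iff.mp hij)

/-- The dimension of the commutant of a square matrix. -/
def commutantDim (A : Matrix (Fin n) (Fin n) k) : ℕ :=
  Module.finrank k (Subalgebra.centralizer k {A})

theorem mem_commutant {A u : Matrix (Fin n) (Fin n) k} :
    u ∈ Subalgebra.centralizer k {A} ↔ A * u = u * A := by
  simp [Subalgebra.mem_centralizer_iff]

theorem commutantDim_algEquiv_le (φ : Matrix (Fin n) (Fin n) k ≃ₐ[k] Matrix (Fin n) (Fin n) k)
    (A : Matrix (Fin n) (Fin n) k) : commutantDim (φ A) ≤ commutantDim A := by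
  let g : Subalgebra.centralizer k {φ A} →ₗ[k] Subalgebra.centralizer k {A} :=
    LinearMap.codRestrict (Subalgebra.toSubmodule (Subalgebra.centralizer k {A}))
      (φ.symm.toLinearMap ∘ₗ (Subalgebra.toSubmodule (Subalgebra.centralizer k {φ A})).subtype)
      (fun u => by
        change _ ∈ Subalgebra.centralizer k {A}
        have h := mem_commutant.mp u.2
        rw [mem_commutant]
        apply φ.injective
        simp only [LinearMap.comp_apply, map_mul, AlgEquiv.toLinearMap_apply,
          AlgEquiv.apply_symm_apply]
        exact h)
  refine LinearMap.finrank_le_finrank_of_injective (f := g) fun u v h => Subtype.ext ?_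
  exact φ.symm.injective (congrArg Subtype.val h)

theorem commutantDim_algEquiv (φ : Matrix (Fin n) (Fin n) k ≃ₐ[k] Matrix (Fin n) (Fin n) k)
    (A : Matrix (Fin n) (Fin n) k) : commutantDim (φ A) = commutantDim A := by
  refine le_antisymm (commutantDim_algEquiv_le φ A) ?_
  simpa using commutantDim_algEquiv_le φ.symm (φ A)

/-- If the commutators of `A` with the lower triangular matrices have their entries in the set `S`
of positions, then the commutant of `A` has dimension at least the number of lower triangular
positions minus the cardinality of `S`. -/
theorem card_le_commutantDim_add_card (A : Matrix (Fin n) (Fin n) k)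
    (S : Finset (Fin n × Fin n))
    (hS : ∀ u : Matrix (Fin n) (Fin n) k, (∀ i j, i < j → u i j = 0) →
      ∀ i j, (i, j) ∉ S → (A * u - u * A) i j = 0) :
    (Finset.univ.filter fun q : Fin n × Fin n => q.2 ≤ q.1).card ≤ commutantDim A + S.card := by
  let D := Finset.univ.filter fun q : Fin n × Fin n => q.2 ≤ q.1
  let M : (D → k) →ₗ[k] Matrix (Fin n) (Fin n) k :=
    { toFun := fun c => Matrix.of fun i j => if h : (i, j) ∈ D then c ⟨(i, j), h⟩ else 0
      map_add' := fun c d => by ext i j; by_cases h : (i, j) ∈ D <;> simp [h]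
      map_smul' := fun r c => by ext i j; by_cases h : (i, j) ∈ D <;> simp [h] }
  have hM : ∀ c i j, i < j → M c i j = 0 := by
    intro c i j hij
    have : (i, j) ∉ D := by simp [D, hij]
    simp [M, this]
  have hMinj : Function.Injective M := by
    intro c d h
    ext ⟨⟨i, j⟩, hq⟩
    have := congrFun (congrFun h i) j
    simpa [M, hq] using this
  let Φ : (D → k) →ₗ[k] (S → k) :=
    LinearMap.pi fun q => Matrix.entryLinearMap k k q.1.1 q.1.2 ∘ₗ
      (LinearMap.mulLeft k A - LinearMap.mulRight k A) ∘ₗ M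
  have hΦ : ∀ c ∈ LinearMap.ker Φ, M c ∈ Subalgebra.centralizer k {A} := by
    intro c hc
    rw [mem_commutant, ← sub_eq_zero]
    ext i j
    by_cases hq : (i, j) ∈ S
    · exact congrFun (LinearMap.mem_ker.mp hc) ⟨(i, j), hq⟩
    · exact hS _ (hM c) i j hq
  have h1 := Φ.finrank_range_add_finrank_ker
  have h2 : Module.finrank k (LinearMap.range Φ) ≤ S.card := by
    refine (Submodule.finrank_le _).trans ?_
    simp
  have h3 : Module.finrank k (LinearMap.ker Φ) ≤ commutantDim A := by
    let g : LinearMap.ker Φ →ₗ[k] Subalgebra.centralizer k {A} :=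
      LinearMap.codRestrict (Subalgebra.toSubmodule (Subalgebra.centralizer k {A}))
        (M ∘ₗ (LinearMap.ker Φ).subtype) (fun c => hΦ c.1 c.2)
    refine LinearMap.finrank_le_finrank_of_injective (f := g) fun u v h => Subtype.ext ?_
    exact hMinj (congrArg Subtype.val h)
  have h4 : Module.finrank k (D → k) = D.card := by simp
  change D.card ≤ _
  omega

theorem card_filter_le_eq (n : ℕ) :
    (Finset.univ.filter fun q : Fin n × Fin n => q.2 ≤ q.1).card =
      (Finset.univ.filter fun q : Fin n × Fin n => q.2 < q.1).card + n := by
  have h : (Finset.univ.filter fun q : Fin n × Fin n => q.2 ≤ q.1) =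
      (Finset.univ.filter fun q : Fin n × Fin n => q.2 < q.1) ∪
        Finset.univ.image fun i : Fin n => (i, i) := by
    ext ⟨i, j⟩
    simp [le_iff_lt_or_eq, eq_comm]
  rw [h, Finset.card_union_of_disjoint, Finset.card_image_of_injective]
  · simp
  · intro i j h; simpa using h
  · rw [Finset.disjoint_left]
    rintro ⟨i, j⟩ h1 h2
    simp at h1 h2
    omega

theorem lower_commutator_apply {A u : Matrix (Fin n) (Fin n) k} (hA : ∀ i j, i < j → A i j = 0)
    (hu : ∀ i j, i < j → u i j = 0) {i j : Fin n} (hij : i ≤ j) : (A * u - u * A) i j = 0 := by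
  have key : ∀ a b : Matrix (Fin n) (Fin n) k, (∀ i j, i < j → a i j = 0) →
      (∀ i j, i < j → b i j = 0) → (a * b) i j = if i = j then a i i * b i i else 0 := by
    intro a b ha hb
    rw [Matrix.mul_apply, Finset.sum_eq_single i]
    · split_ifs with h
      · rw [h]
      · rw [hb i j (lt_of_le_of_ne hij h), mul_zero]
    · intro l _ hl
      rcases lt_or_gt_of_ne hl with h | h
      · rw [hb l j (h.trans_le hij), mul_zero]
      · rw [ha i l h, zero_mul]
    · simp
  rw [Matrix.sub_apply, key A u hA hu, key u A hu hA]
  split_ifs <;> ring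

/-- For lower triangular `A`, bracketing with `A` sends lower triangular matrices to strictly lower
triangular ones, a space smaller by `n` dimensions. -/
theorem le_commutantDim [IsAlgClosed k] (A : Matrix (Fin n) (Fin n) k) : n ≤ commutantDim A := by
  obtain ⟨b, hb⟩ := exists_triangular_basis n (Fin n → k) (by simp) (Matrix.toLin' A)
  let φ : Matrix (Fin n) (Fin n) k ≃ₐ[k] Matrix (Fin n) (Fin n) k :=
    Matrix.toLinAlgEquiv'.trans (LinearMap.toMatrixAlgEquiv b)
  have hφ : ∀ i j, i < j → φ A i j = 0 := by
    intro i j hij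
    change LinearMap.toMatrixAlgEquiv b (Matrix.toLin' A) i j = 0
    rw [LinearMap.toMatrixAlgEquiv_apply]
    exact hb i j hij
  rw [← commutantDim_algEquiv φ A]
  have := card_le_commutantDim_add_card (φ A)
    (Finset.univ.filter fun q : Fin n × Fin n => q.2 < q.1) (fun u hu i j hij => by
      simp only [Finset.mem_filter, Finset.mem_univ, true_and, not_lt] at hij
      exact lower_commutator_apply hφ hu hij)
  rw [card_filter_le_eq] at this
  omega

/-- A lower triangular nilpotent matrix with a zero entry just below the diagonal has a commutant
of dimension greater than its size. -/
theorem lt_commutantDim_of_lower {A : Matrix (Fin n) (Fin n) k} (hA : ∀ i j, i ≤ j → A i j = 0)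
    {s t : Fin n} (hst : (t : ℕ) + 1 = s) (h0 : A s t = 0) : n < commutantDim A := by
  have hts : t < s := by rw [Fin.lt_def]; omega
  -- The `(s, t)` entry of the commutator is `A s t * (u t t - u s s)`, so its vanishing costs no
  -- condition and the bound gains one.
  have h1 := card_le_commutantDim_add_card A
    ((Finset.univ.filter fun q : Fin n × Fin n => q.2 < q.1).erase (s, t)) (fun u hu i j hij => by
      rw [Finset.mem_erase] at hij
      simp only [Finset.mem_filter, Finset.mem_univ, true_and, not_and', not_not, ne_eq] at hij
      rcases le_or_gt i j with h | h
      · exact lower_commutator_apply (fun i j h => hA i j h.le) hu h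
      · obtain ⟨rfl, rfl⟩ := Prod.mk.injEq _ _ _ _ ▸ hij h
        rw [Matrix.sub_apply, Matrix.mul_apply, Matrix.mul_apply, Finset.sum_eq_zero,
          Finset.sum_eq_zero, sub_zero]
        · intro l _
          rcases lt_trichotomy l i with h' | rfl | h'
          · rw [hA l j (by rw [Fin.le_def]; rw [Fin.lt_def] at h'; omega), mul_zero]
          · rw [h0, mul_zero]
          · rw [hu i l h', zero_mul]
        · intro l _
          rcases lt_trichotomy l j with h' | rfl | h'
          · rw [hu l j h', mul_zero]
          · rw [h0, zero_mul]
          · rw [hA i l (by rw [Fin.le_def]; rw [Fin.lt_def] at h'; omega), zero_mul])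
  rw [card_filter_le_eq, Finset.card_erase_of_mem (by simp [hts])] at h1
  have : 0 < (Finset.univ.filter fun q : Fin n × Fin n => q.2 < q.1).card :=
    Finset.card_pos.mpr ⟨(s, t), by simp [hts]⟩
  omega

/-- A lower triangular nilpotent matrix with no zero entry just below the diagonal has a commutant
of dimension at most its size. -/
theorem commutantDim_le_of_lower {A : Matrix (Fin n) (Fin n) k} (hA : ∀ i j, i ≤ j → A i j = 0)
    (h1 : ∀ s t : Fin n, (t : ℕ) + 1 = s → A s t ≠ 0) : commutantDim A ≤ n := by
  rcases Nat.eq_zero_or_pos n with rfl | hn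
  · exact (Submodule.finrank_le (Subalgebra.toSubmodule (Subalgebra.centralizer k {A}))).trans
      (by rw [Module.finrank_matrix]; simp)
  let o : Fin n := ⟨0, hn⟩
  -- The first basis vector is cyclic for `A`, so an element of the commutant is determined by its
  -- first column.
  let g : Subalgebra.centralizer k {A} →ₗ[k] (Fin n → k) :=
    LinearMap.pi fun i => Matrix.entryLinearMap k k i o ∘ₗ
      (Subalgebra.toSubmodule (Subalgebra.centralizer k {A})).subtype
  have hg : Function.Injective g := by
    rw [injective_iff_map_eq_zero]
    intro u hu
    have hcol : ∀ i, u.val i o = 0 := fun i => congrFun hu i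
    let K := LinearMap.ker (Matrix.mulVecLin u.val)
    have hKA : ∀ v ∈ K, A.mulVec v ∈ K := by
      intro v hv
      rw [LinearMap.mem_ker, Matrix.mulVecLin_apply] at hv ⊢
      rw [Matrix.mulVec_mulVec, ← mem_commutant.mp u.2, ← Matrix.mulVec_mulVec, hv,
        Matrix.mulVec_zero]
    have hoK : Pi.single o 1 ∈ K := by
      rw [LinearMap.mem_ker, Matrix.mulVecLin_apply]
      ext i
      simp [hcol]
    let F : ℕ → Submodule k (Fin n → k) := fun m =>
      { carrier := {v | ∀ i : Fin n, (i : ℕ) < m → v i = 0}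
        add_mem' := fun hv hw i hi => by simp [hv i hi, hw i hi]
        zero_mem' := fun i _ => rfl
        smul_mem' := fun c v hv i hi => by simp [hv i hi] }
    have hFA : ∀ m, ∀ v ∈ F m, A.mulVec v ∈ F (m + 1) := by
      intro m v hv i hi
      rw [Matrix.mulVec, dotProduct]
      refine Finset.sum_eq_zero fun j _ => ?_
      by_cases hj : (j : ℕ) < m
      · rw [hv j hj, mul_zero]
      · rw [hA i j (by rw [Fin.le_def]; omega), zero_mul]
    -- The witness is `A ^ m` applied to the first basis vector; its leading coefficient is a
    -- product of subdiagonal entries.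
    have hlead : ∀ (m : ℕ) (hm : m < n), ∃ v ∈ K, v ∈ F m ∧ v ⟨m, hm⟩ ≠ 0 := by
      intro m
      induction m with
      | zero => exact fun hm => ⟨_, hoK, fun i hi => absurd hi (Nat.not_lt_zero _), by simp [o]⟩
      | succ m ih =>
        intro hm
        obtain ⟨v, hvK, hvF, hv⟩ := ih (by omega)
        refine ⟨_, hKA v hvK, hFA m v hvF, ?_⟩
        rw [Matrix.mulVec, dotProduct, Finset.sum_eq_single ⟨m, by omega⟩]
        · exact mul_ne_zero (h1 _ _ rfl) hv
        · intro j _ hj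
          rcases lt_or_ge (j : ℕ) m with h | h
          · rw [hvF j h, mul_zero]
          · have : (j : ℕ) ≠ m := fun h => hj (Fin.ext h)
            rw [hA _ j (by rw [Fin.le_def]; change m + 1 ≤ _; omega), zero_mul]
        · simp
    have hall : ∀ d m, n ≤ m + d → F m ≤ K := by
      intro d
      induction d with
      | zero =>
        intro m hm v hv
        have : v = 0 := by ext i; exact hv i (by omega)
        rw [this]; exact K.zero_mem
      | succ d ih =>
        intro m hm v hv
        rcases lt_or_ge m n with hmn | hmn
        · obtain ⟨w, hwK, hwF, hw⟩ := hlead m hmn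
          have hsub : v - (v ⟨m, hmn⟩ / w ⟨m, hmn⟩) • w ∈ K := by
            refine ih (m + 1) (by omega) fun i hi => ?_
            rcases Nat.lt_succ_iff_lt_or_eq.mp hi with h | h
            · simp [hv i h, hwF i h]
            · have : i = ⟨m, hmn⟩ := Fin.ext h
              subst this
              simp [hw]
          have := K.add_mem hsub (K.smul_mem (v ⟨m, hmn⟩ / w ⟨m, hmn⟩) hwK)
          simpa using this
        · have : v = 0 := by ext i; exact hv i (by omega)
          rw [this]; exact K.zero_mem
    ext i j
    have := LinearMap.mem_ker.mp (hall n 0 (by omega)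
      (show Pi.single j 1 ∈ F 0 from fun i hi => absurd hi (Nat.not_lt_zero _)))
    have := congrFun this i
    simpa using this
  calc commutantDim A ≤ Module.finrank k (Fin n → k) :=
        LinearMap.finrank_le_finrank_of_injective hg
    _ = n := by simp

/-- The stabilizer is the kernel of the trace on the commutant, and the trace is onto there since
the identity has trace `n ≠ 0`. -/
theorem finrank_stabilizer_add_one [CharZero k] (hn : n ≠ 0) (x : sl (Fin n) k) :
    Module.finrank k (stabilizer k (sl (Fin n) k) (killingForm k (sl (Fin n) k) x)) + 1 =
      commutantDim x.val := by
  let T : Subalgebra.centralizer k {x.val} →ₗ[k] k :=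
    Matrix.traceLinearMap (Fin n) k k ∘ₗ
      (Subalgebra.toSubmodule (Subalgebra.centralizer k {x.val})).subtype
  have hT : T ≠ 0 := by
    intro h
    have h1 : Matrix.trace (1 : Matrix (Fin n) (Fin n) k) = 0 := LinearMap.congr_fun h 1
    have : (n : k) = 0 := by simpa using h1
    exact hn (Nat.cast_eq_zero.mp this)
  have h1 := T.finrank_range_add_finrank_ker
  rw [LinearMap.range_eq_top.mpr (LinearMap.surjective hT), finrank_top, Module.finrank_self] at h1
  rw [commutantDim, ← h1, add_comm]
  congr 1
  refine LinearEquiv.finrank_eq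
    { toFun := fun u => ⟨⟨u.1.1, mem_commutant.mpr ((mem_stabilizer_killingForm hn x _).mp u.2)⟩,
        trace_sl u.1⟩
      invFun := fun u => ⟨⟨u.1.1, u.2⟩,
        (mem_stabilizer_killingForm hn x _).mpr (mem_commutant.mp u.1.2)⟩
      map_add' := fun _ _ => rfl
      map_smul' := fun _ _ => rfl
      left_inv := fun _ => rfl
      right_inv := fun _ => rfl }

/-- The reversal `rev` turns matrices that increase for `e` into lower triangular ones, the form
used in the bounds above. -/
theorem commutantDim_submatrix (e : Equiv.Perm (Fin n)) (A : Matrix (Fin n) (Fin n) k) :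
    commutantDim (A.submatrix (fun i => e i.rev) (fun i => e i.rev)) = commutantDim A :=
  commutantDim_algEquiv (Matrix.reindexAlgEquiv k k (Fin.revPerm.trans e).symm) A

/-- The matrix `A` is strictly triangular for the total order of the indices given by `e`. -/
def IsTriangularFor (e : Equiv.Perm (Fin n)) (A : Matrix (Fin n) (Fin n) k) : Prop :=
  ∀ i j, A i j ≠ 0 → e.symm i < e.symm j

theorem IsTriangularFor.submatrix_eq_zero {e : Equiv.Perm (Fin n)}
    {A : Matrix (Fin n) (Fin n) k} (hA : IsTriangularFor e A) (i j : Fin n) (hij : i ≤ j) :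
    A.submatrix (fun i => e i.rev) (fun i => e i.rev) i j = 0 := by
  by_contra h
  have := hA _ _ h
  simp only [Equiv.symm_apply_apply, Fin.rev_lt_rev] at this
  exact absurd hij (not_le.mpr this)

variable [CharZero k] {e : Equiv.Perm (Fin n)} {x : sl (Fin n) k}

/-- A matrix strictly triangular for a total order of the indices, with no zero entry at two
successive indices, is regular nilpotent. -/
theorem IsTriangularFor.mem_regNullcone [IsAlgClosed k] (hx : IsTriangularFor e x.val)
    (h1 : ∀ s t : Fin n, (s : ℕ) + 1 = t → x.val (e s) (e t) ≠ 0) :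
    killingForm k (sl (Fin n) k) x ∈ regNullcone k (sl (Fin n) k) := by
  refine ⟨killingForm_mem_nullcone (w := fun i => e.symm i) hx, fun g => ?_⟩
  rcases eq_or_ne n 0 with rfl | hn
  · rw [Subsingleton.elim g (killingForm k (sl (Fin 0) k) x)]
  obtain ⟨y, rfl⟩ := killingForm_sl_surjective hn g
  have h2 : commutantDim x.val ≤ n := by
    rw [← commutantDim_submatrix e]
    refine commutantDim_le_of_lower hx.submatrix_eq_zero fun s t hst => h1 _ _ ?_
    rw [Fin.val_rev, Fin.val_rev]
    omega
  have h3 := finrank_stabilizer_add_one hn x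
  have h4 := finrank_stabilizer_add_one hn y
  have h5 := le_commutantDim y.val
  omega

/-- A matrix strictly triangular for a total order of the indices, with a zero entry at two
successive indices, is not regular if there is a regular nilpotent matrix. -/
theorem IsTriangularFor.notMem_regNullcone (hx : IsTriangularFor e x.val) {s t : Fin n}
    (hst : (s : ℕ) + 1 = t) (h0 : x.val (e s) (e t) = 0) {e' : Equiv.Perm (Fin n)}
    {y : sl (Fin n) k} (hy : IsTriangularFor e' y.val)
    (h1 : ∀ s t : Fin n, (s : ℕ) + 1 = t → y.val (e' s) (e' t) ≠ 0) :
    killingForm k (sl (Fin n) k) x ∉ regNullcone k (sl (Fin n) k) := by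
  rintro ⟨-, hreg⟩
  have hn : n ≠ 0 := s.pos.ne'
  have h2 : n < commutantDim x.val := by
    rw [← commutantDim_submatrix e]
    refine lt_commutantDim_of_lower (s := s.rev) (t := t.rev) hx.submatrix_eq_zero ?_ (by simpa)
    rw [Fin.val_rev, Fin.val_rev]
    omega
  have h3 : commutantDim y.val ≤ n := by
    rw [← commutantDim_submatrix e']
    refine commutantDim_le_of_lower hy.submatrix_eq_zero fun s t hst => h1 _ _ ?_
    rw [Fin.val_rev, Fin.val_rev]
    omega
  have h4 := finrank_stabilizer_add_one hn x
  have h5 := finrank_stabilizer_add_one hn y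
  have h6 := hreg (killingForm k (sl (Fin n) k) y)
  omega

end Regular

/-! ### Krull dimension of an infinite cofinite space with finitely many extra points. -/

section Topology

theorem subsingleton_of_isIrreducible_of_finite {Y : Type*} [TopologicalSpace Y] [T1Space Y]
    {s : Set Y} (hs : IsIrreducible s) (hfin : s.Finite) : s.Subsingleton := by
  classical
  obtain ⟨z, hz, hsz⟩ := isIrreducible_iff_sUnion_isClosed.mp hs
    (hfin.toFinset.image fun y => {y})
    (by
      intro z hz
      obtain ⟨y, -, rfl⟩ := Finset.mem_image.mp hz
      exact isClosed_singleton)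
    (fun y hy => ⟨{y}, by simpa using hy, rfl⟩)
  obtain ⟨y, -, rfl⟩ := Finset.mem_image.mp hz
  exact Set.subsingleton_singleton.anti hsz

/-- A `T1` space consisting of an infinite closed set `C` with the cofinite topology and of finitely
many points has dimension one. -/
theorem topologicalKrullDim_eq_one {Y : Type*} [TopologicalSpace Y] [T1Space Y] {C : Set Y}
    (hC : IsClosed C) (hirr : IsIrreducible C) (hinf : C.Infinite) (hfin : Cᶜ.Finite)
    (h : ∀ A : Set Y, IsClosed A → C ⊆ A ∨ (A ∩ C).Finite) : topologicalKrullDim Y = 1 := by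
  have key : ∀ D : TopologicalSpace.IrreducibleCloseds Y,
      (D : Set Y).Subsingleton ∨ (D : Set Y) = C := by
    intro D
    rcases h D D.isClosed with hD | hD
    · right
      rcases isPreirreducible_iff_isClosed_union_isClosed.mp D.isIrreducible.isPreirreducible
        C Cᶜ hC hfin.isClosed (by simp) with h1 | h1
      · exact h1.antisymm hD
      · exact absurd (hfin.subset (hD.trans h1)) hinf
    · left
      refine subsingleton_of_isIrreducible_of_finite D.isIrreducible
        ((hD.union hfin).subset fun y hy => ?_)
      by_cases hyC : y ∈ C
      · exact Or.inl ⟨hy, hyC⟩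
      · exact Or.inr hyC
  refine le_antisymm (Order.krullDim_le_one_iff.mpr fun D => ?_)
    (Order.one_le_krullDim_iff.mpr ?_)
  · rcases key D with hD | hD
    · left
      intro D' hD' y hy
      obtain ⟨y', hy'⟩ := D'.isIrreducible.nonempty
      rwa [hD hy (hD' hy')]
    · right
      intro D' hD'
      rcases key D' with h' | h'
      · have : C ⊆ D' := hD ▸ hD'
        exact absurd (h'.finite.subset this) hinf
      · intro y hy
        have : y ∈ C := h' ▸ hy
        change y ∈ (D : Set Y)
        rwa [hD]
  · obtain ⟨y, hy⟩ := hinf.nonempty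
    refine ⟨⟨{y}, isIrreducible_singleton, isClosed_singleton⟩, ⟨C, hirr, hC⟩, ?_⟩
    refine lt_of_le_of_ne (fun z hz => ?_) fun heq => ?_
    · rw [Set.mem_singleton_iff.mp hz]; exact hy
    · have : ({y} : Set Y) = C := congrArg TopologicalSpace.IrreducibleCloseds.carrier heq
      exact hinf (this ▸ Set.finite_singleton y)

end Topology

/-! ### Affine lines in the Zariski topology of the dual. -/

section Zariski

variable {k : Type*} [Field k] {a : Type*} [LieRing a] [LieAlgebra k a]

theorem isClosed_zeroLocus (F : SymmetricAlgebra k a) :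
    @IsClosed _ (zariski k a) {f | evalAt k a f F = 0} := by
  let _ := zariski k a
  rw [← isOpen_compl_iff]
  exact TopologicalSpace.isOpen_generateFrom_of_mem ⟨F, rfl⟩

/-- The restriction of polynomial functions to the parametrized line `c ↦ f + c g`. -/
def restrictLine (f g : Module.Dual k a) : SymmetricAlgebra k a →ₐ[k] Polynomial k :=
  SymmetricAlgebra.lift ((Algebra.linearMap k (Polynomial k)) ∘ₗ f +
    (LinearMap.toSpanSingleton k (Polynomial k) Polynomial.X) ∘ₗ g)

theorem eval_restrictLine (f g : Module.Dual k a) (c : k) (F : SymmetricAlgebra k a) :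
    (restrictLine f g F).eval c = evalAt k a (f + c • g) F := by
  have : (Polynomial.aeval c).comp (restrictLine f g) = evalAt k a (f + c • g) := by
    apply SymmetricAlgebra.algHom_ext
    ext y
    simp [restrictLine, evalAt, mul_comm]
  rw [← this, AlgHom.comp_apply, Polynomial.coe_aeval_eq_eval]

/-- A polynomial function restricts to a one-variable polynomial in `c`, which is zero or has
finitely many roots. The alternative survives finite intersections and arbitrary unions. -/
theorem isOpen_inter_line (f g : Module.Dual k a) {U : Set (Module.Dual k a)}
    (hU : @IsOpen _ (zariski k a) U) :
    (∀ c : k, f + c • g ∉ U) ∨ {c : k | f + c • g ∉ U}.Finite := by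
  induction hU with
  | basic U hU =>
    obtain ⟨F, rfl⟩ := hU
    simp only [Set.mem_ofPred_eq, not_not, ← eval_restrictLine]
    by_cases h : restrictLine f g F = 0
    · left; simp [h]
    · right
      exact (Polynomial.finite_setOfPred_isRoot h)
  | univ => right; simp
  | inter U V _ _ hU hV =>
    rcases hU with hU | hU
    · exact Or.inl fun c hc => hU c hc.1
    rcases hV with hV | hV
    · exact Or.inl fun c hc => hV c hc.2
    · refine Or.inr ((hU.union hV).subset fun c hc => ?_)
      by_cases h : f + c • g ∈ U
      · exact Or.inr fun h' => hc ⟨h, h'⟩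
      · exact Or.inl h
  | sUnion S _ hS =>
    by_cases h : ∃ U ∈ S, {c : k | f + c • g ∉ U}.Finite
    · obtain ⟨U, hU, hfin⟩ := h
      exact Or.inr (hfin.subset fun c hc h' => hc ⟨U, hU, h'⟩)
    · push Not at h
      refine Or.inl fun c ⟨U, hU, hc⟩ => ?_
      exact (hS U hU).resolve_right (h U hU) c hc

/-- The line is cut out by the affine equations `x = f x` for `x` in the kernel of `g`. The case `g
= 0` gives closed points. -/
theorem isClosed_line (f g : Module.Dual k a) :
    @IsClosed _ (zariski k a) (Set.range fun c : k => f + c • g) := by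
  let _ := zariski k a
  have h : (Set.range fun c : k => f + c • g) = ⋂ x ∈ LinearMap.ker g,
      {f' | evalAt k a f' (SymmetricAlgebra.ι k a x - algebraMap k _ (f x)) = 0} := by
    ext f'
    simp only [Set.mem_range, Set.mem_iInter, Set.mem_ofPred_eq, map_sub, evalAt,
      SymmetricAlgebra.lift_ι_apply, AlgHom.commutes, Algebra.algebraMap_self, RingHom.id_apply,
      sub_eq_zero, LinearMap.mem_ker]
    constructor
    · rintro ⟨c, rfl⟩ x hx
      simp [hx]
    · intro h
      by_cases hg : g = 0
      · refine ⟨0, LinearMap.ext fun x => ?_⟩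
        simpa using (h x (by simp [hg])).symm
      · obtain ⟨y, hy⟩ : ∃ y, g y ≠ 0 := by
          by_contra! h'
          exact hg (LinearMap.ext h')
        refine ⟨(f' y - f y) / g y, LinearMap.ext fun x => ?_⟩
        have := h (x - (g x / g y) • y) (by simp [hy])
        simp only [map_sub, map_smul, smul_eq_mul, LinearMap.add_apply,
          LinearMap.smul_apply] at this ⊢
        field_simp at this ⊢
        linear_combination -this
  rw [h]
  exact isClosed_biInter fun x _ => isClosed_zeroLocus _

theorem t1Space_zariski : @T1Space _ (zariski k a) := by
  let _ := zariski k a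
  refine ⟨fun f => ?_⟩
  have := isClosed_line f 0
  simpa using this

theorem isIrred_line (f g : Module.Dual k a) {S : Set k} (hS : S.Infinite) :
    IsIrred k a ((fun c : k => f + c • g) '' S) := by
  let _ := zariski k a
  refine ⟨hS.nonempty.image _, ?_⟩
  rintro U V hU hV ⟨_, ⟨c, -, rfl⟩, hcU⟩ ⟨_, ⟨d, -, rfl⟩, hdV⟩
  have h1 := (isOpen_inter_line f g hU).resolve_left fun h => h c hcU
  have h2 := (isOpen_inter_line f g hV).resolve_left fun h => h d hdV
  obtain ⟨b, hb, hb'⟩ := (hS.sdiff (h1.union h2)).nonempty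
  simp only [Set.mem_union, Set.mem_ofPred_eq, not_or, not_not] at hb'
  exact ⟨_, ⟨b, hb, rfl⟩, hb'⟩

/-- A proper `S` accounts for the punctured line. Since `E` avoids the whole line, the part over `S`
is the trace of a closed set. -/
theorem dimension_line_union (f g : Module.Dual k a) (hg : g ≠ 0) {S : Set k} (hS : S.Infinite)
    {E : Set (Module.Dual k a)} (hE : E.Finite) (hdisj : ∀ z ∈ E, ∀ c : k, f + c • g ≠ z) :
    dimension k a ((fun c : k => f + c • g) '' S ∪ E) = 1 := by
  let _ := zariski k a
  have := t1Space_zariski (k := k) (a := a)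
  set L : k → Module.Dual k a := fun c => f + c • g
  have hLinj : Function.Injective L := by
    intro c d h
    exact smul_left_injective k hg (add_left_cancel h)
  set Z := L '' S ∪ E
  let C : Set Z := Subtype.val ⁻¹' (L '' S)
  have hval : Subtype.val '' C = L '' S := by
    rw [Subtype.image_preimage_coe, Set.inter_eq_right]
    exact Set.subset_union_left
  have hCeq : C = Subtype.val ⁻¹' (Set.range L) := by
    ext ⟨z, hz⟩
    constructor
    · rintro ⟨c, -, h⟩; exact ⟨c, h⟩
    · rintro ⟨c, h⟩
      rcases hz with hz | hz
      · exact hz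
      · exact absurd h (hdisj z hz c)
  have hC : IsClosed C := by
    rw [hCeq]
    exact (isClosed_line f g).preimage continuous_subtype_val
  have hinf : C.Infinite := by
    refine Set.Infinite.of_image Subtype.val ?_
    rw [hval]
    exact hS.image hLinj.injOn
  have hfin : Cᶜ.Finite := by
    refine Set.Finite.of_finite_image (f := Subtype.val) (hE.subset ?_) Subtype.val_injective.injOn
    rintro _ ⟨⟨z, hz⟩, hzC, rfl⟩
    exact hz.resolve_left hzC
  have hirr : IsIrreducible C := by
    have h1 : IsIrreducible (Subtype.val '' C) := by
      rw [hval]; exact isIrred_line f g hS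
    refine ⟨hinf.nonempty, ?_⟩
    rintro U V hU hV ⟨u, huC, hu⟩ ⟨v, hvC, hv⟩
    obtain ⟨U', hU', rfl⟩ := isOpen_induced_iff.mp hU
    obtain ⟨V', hV', rfl⟩ := isOpen_induced_iff.mp hV
    obtain ⟨_, ⟨w, hwC, rfl⟩, hw⟩ := h1.2 U' V' hU' hV' ⟨u, ⟨u, huC, rfl⟩, hu⟩
      ⟨v, ⟨v, hvC, rfl⟩, hv⟩
    exact ⟨w, hwC, hw⟩
  refine topologicalKrullDim_eq_one hC hirr hinf hfin fun A hA => ?_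
  obtain ⟨A', hA', rfl⟩ := isClosed_induced_iff.mp hA
  rcases isOpen_inter_line f g hA'.isOpen_compl with h | h
  · left
    rintro ⟨z, hz⟩ ⟨c, -, rfl⟩
    exact Set.notMem_compl_iff.mp (h c)
  · right
    refine Set.Finite.of_finite_image (f := Subtype.val) ((h.image L).subset ?_)
      Subtype.val_injective.injOn
    rintro _ ⟨⟨z, hz⟩, ⟨hzA, ⟨c, -, rfl⟩⟩, rfl⟩
    exact ⟨c, Set.notMem_compl_iff.mpr hzA, rfl⟩

end Zariski

/-! ### The meander graph and total orders adapted to it. -/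

section Meander

variable {n p : ℕ}

/-- The meander graph of the parabolic with blocks of sizes `p` and `n - p`, with the orientation
given by the roots of `𝒦 ∪ (-𝒦')`. -/
def MeanderEdge (n p : ℕ) (i j : Fin n) : Prop :=
  ((i : ℕ) < j ∧ (i : ℕ) + j + 1 = n) ∨ ((j : ℕ) < i ∧ (i : ℕ) + j + 1 = p) ∨
    ((j : ℕ) < i ∧ p ≤ j ∧ (i : ℕ) + j + 1 = n + p)

theorem mem_cascade_simpleRoots (hn : 0 < n) {γ : Fin n × Fin n} :
    γ ∈ cascade (simpleRoots n) ↔ (γ.1 : ℕ) < γ.2 ∧ (γ.1 : ℕ) + γ.2 + 1 = n := by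
  constructor
  · rintro ⟨h1, r, s, ⟨-, -, hr, hs⟩, -, -, h⟩
    simp only [simpleRoots, Set.mem_Ico, not_and, not_lt] at hr hs
    have := r.2
    have := s.2
    exact ⟨h1, by omega⟩
  · rintro ⟨h1, h2⟩
    refine ⟨h1, ⟨0, hn⟩, ⟨n - 1, by omega⟩, ⟨?_, ?_, ?_, ?_⟩, ?_, ?_, ?_⟩
    · simp [Fin.le_def]
    · intro l hl1 hl2
      simp only at hl1 hl2
      simp only [simpleRoots, Set.mem_Ico]
      omega
    · simp [simpleRoots]
    · simp only [simpleRoots, Set.mem_Ico]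
      omega
    · simp [Fin.le_def]
    · rw [Fin.le_def]
      simp only
      omega
    · simp only
      omega

theorem mem_cascade_sdiff (hp : 1 ≤ p) (hpn : p < n) {γ : Fin n × Fin n} :
    γ ∈ cascade (simpleRoots n \ {p}) ↔ (γ.1 : ℕ) < γ.2 ∧
      ((γ.1 : ℕ) + γ.2 + 1 = p ∨ p ≤ (γ.1 : ℕ) ∧ (γ.1 : ℕ) + γ.2 + 1 = n + p) := by
  constructor
  · rintro ⟨h1, r, s, ⟨hrs, hsupp, hr, hs⟩, hr1, hs1, h⟩
    have h2 : ¬ ((r : ℕ) < p ∧ p ≤ s) := fun h => (hsupp p h.1 h.2).2 rfl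
    simp only [simpleRoots, Set.mem_sdiff, Set.mem_Ico, Set.mem_singleton_iff] at hr hs
    rw [Fin.le_def] at hrs hr1 hs1
    have := r.2
    have := s.2
    exact ⟨h1, by omega⟩
  · rintro ⟨h1, h2 | ⟨h2, h3⟩⟩
    · refine ⟨h1, ⟨0, by omega⟩, ⟨p - 1, by omega⟩, ⟨?_, ?_, ?_, ?_⟩, ?_, ?_, ?_⟩
      · simp [Fin.le_def]
      · intro l hl1 hl2
        simp only at hl1 hl2
        simp only [simpleRoots, Set.mem_sdiff, Set.mem_Ico, Set.mem_singleton_iff]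
        omega
      · simp [simpleRoots]
      · simp only [simpleRoots, Set.mem_sdiff, Set.mem_Ico, Set.mem_singleton_iff]
        omega
      · simp [Fin.le_def]
      · rw [Fin.le_def]
        simp only
        omega
      · simp only
        omega
    · refine ⟨h1, ⟨p, by omega⟩, ⟨n - 1, by omega⟩, ⟨?_, ?_, ?_, ?_⟩, ?_, ?_, ?_⟩
      · rw [Fin.le_def]
        simp only
        omega
      · intro l hl1 hl2
        simp only at hl1 hl2
        simp only [simpleRoots, Set.mem_sdiff, Set.mem_Ico, Set.mem_singleton_iff]
        omega
      · simp [simpleRoots]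
      · simp only [simpleRoots, Set.mem_sdiff, Set.mem_Ico, Set.mem_singleton_iff]
        omega
      · rw [Fin.le_def]
        exact h2
      · rw [Fin.le_def]
        simp only
        omega
      · simp only
        omega

theorem mem_cascadeRoots (hp : 1 ≤ p) (hpn : p < n) {γ : Fin n × Fin n} :
    γ ∈ cascadeRoots (simpleRoots n) (simpleRoots n \ {p}) ↔ MeanderEdge n p γ.1 γ.2 := by
  rw [cascadeRoots, Set.mem_union, Set.mem_ofPred_eq, mem_cascade_simpleRoots (by omega),
    mem_cascade_sdiff hp hpn, MeanderEdge]
  simp only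
  omega

theorem not_even_and_even (hcop : Nat.Coprime p n) : ¬ (p % 2 = 0 ∧ n % 2 = 0) := by
  rintro ⟨h1, h2⟩
  have := Nat.dvd_gcd (Nat.dvd_of_mod_eq_zero h1) (Nat.dvd_of_mod_eq_zero h2)
  rw [hcop] at this
  omega

/-- The cascade of an interval contains a simple root exactly when the interval has even length, and
exactly one of `n`, `p`, `n - p` is even. -/
theorem existsUnique_simple_meanderEdge (hp : 1 ≤ p) (hpn : p < n) (hcop : Nat.Coprime p n) :
    ∃! γ : Fin n × Fin n, MeanderEdge n p γ.1 γ.2 ∧ IsSimpleUpToSign γ := by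
  have hpar := not_even_and_even hcop
  refine existsUnique_of_exists_of_unique ?_ ?_
  · rcases Nat.even_or_odd' n with ⟨m, h | h⟩
    · refine ⟨(⟨m - 1, by omega⟩, ⟨m, by omega⟩), ?_, ?_⟩
      · simp only [MeanderEdge]; omega
      · simp only [IsSimpleUpToSign]; omega
    · rcases Nat.even_or_odd' p with ⟨q, h' | h'⟩
      · refine ⟨(⟨q, by omega⟩, ⟨q - 1, by omega⟩), ?_, ?_⟩
        · simp only [MeanderEdge]; omega
        · simp only [IsSimpleUpToSign]; omega
      · refine ⟨(⟨m + q + 1, by omega⟩, ⟨m + q, by omega⟩), ?_, ?_⟩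
        · simp only [MeanderEdge]; omega
        · exact Or.inr rfl
  · rintro ⟨i, j⟩ ⟨i', j'⟩ ⟨h1, h2⟩ ⟨h3, h4⟩
    simp only [MeanderEdge, IsSimpleUpToSign] at h1 h2 h3 h4
    ext <;> simp only <;> omega

/-- For coprime `p` and `n` the meander graph is a path: its vertices can be numbered in such a way
that each edge joins two vertices with successive numbers. -/
theorem exists_path_numbering (hp : 1 ≤ p) (hpn : p < n) (hcop : Nat.Coprime p n) :
    ∃ pos : Fin n → ℕ, Function.Injective pos ∧
      ∀ i j, MeanderEdge n p i j → pos j = pos i + 1 ∨ pos i = pos j + 1 := by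
  -- Modulo `n`, the two cascades are the reflections `v ↦ -1 - v` and `v ↦ p - 1 - v`, and `v₀` is
  -- fixed by the second. In the coordinate `v = v₀ + p m` they become `m ↦ -1 - m` and `m ↦ -m`.
  obtain ⟨v₀, hv₀⟩ : ∃ v₀ : ℤ, (n : ℤ) ∣ 2 * v₀ + 1 - p := by
    have hpar := not_even_and_even hcop
    rcases Nat.even_or_odd' p with ⟨q, h | h⟩
    · obtain ⟨m, hm⟩ : ∃ m, n = 2 * m + 1 := ⟨n / 2, by omega⟩
      exact ⟨q + m, 1, by push_cast [h, hm]; ring⟩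
    · exact ⟨q, 0, by push_cast [h]; ring⟩
  have hcopZ : IsCoprime (n : ℤ) (p : ℤ) := (Nat.isCoprime_iff_coprime.mpr hcop).symm
  have hcancel : ∀ a : ℤ, (n : ℤ) ∣ p * a → (n : ℤ) ∣ a := fun a h => hcopZ.dvd_of_dvd_mul_left h
  have hex : ∀ v : Fin n, ∃ m : ℕ, m < n ∧ (n : ℤ) ∣ v₀ + p * m - v := by
    intro v
    obtain ⟨a, b, hab⟩ := hcopZ
    have hn0 : (0 : ℤ) < n := by omega
    refine ⟨((b * (v - v₀)) % n).toNat, ?_, ?_⟩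
    · have := Int.emod_lt_of_pos (b * (v - v₀)) hn0
      have := Int.emod_nonneg (b * (v - v₀)) hn0.ne'
      omega
    · rw [Int.toNat_of_nonneg (Int.emod_nonneg _ hn0.ne'), Int.emod_def]
      refine ⟨-a * (v - v₀) - p * (b * (v - v₀) / n), ?_⟩
      linear_combination (v - v₀ : ℤ) * hab
  choose m hm hmv using hex
  have hminj : ∀ v w, m v = m w → v = w := by
    intro v w h
    have h1 := dvd_sub (hmv v) (hmv w)
    rw [h] at h1
    have h2 : (n : ℤ) ∣ (w : ℤ) - v := by
      have h4 : (w : ℤ) - v = v₀ + p * m w - v - (v₀ + p * m w - w) := by ring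
      rwa [h4]
    have h3 := Int.eq_zero_of_abs_lt_dvd h2 (by
      have := v.2
      have := w.2
      rw [abs_lt]
      omega)
    exact Fin.ext (by omega)
  have hK : ∀ v w : Fin n, (v : ℕ) + w + 1 = n → m v + m w + 1 = n := by
    intro v w h
    have h1 : (n : ℤ) ∣ ((m v + m w + 1 : ℕ) : ℤ) := by
      refine hcancel _ ?_
      have h2 := dvd_sub (dvd_add (hmv v) (hmv w)) hv₀
      have h3 := dvd_add h2 (dvd_refl (n : ℤ))
      have h4 : (v : ℤ) + w + 1 = n := by exact_mod_cast h
      have h5 : (p : ℤ) * ((m v + m w + 1 : ℕ) : ℤ) =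
          v₀ + p * m v - v + (v₀ + p * m w - w) - (2 * v₀ + 1 - p) + n := by
        push_cast
        linear_combination h4
      rwa [h5]
    obtain ⟨c, hc⟩ := Int.natCast_dvd_natCast.mp h1
    have := hm v
    have := hm w
    have : c < 2 := by
      by_contra! h2
      have := Nat.mul_le_mul_left n h2
      omega
    have : c ≠ 0 := by rintro rfl; omega
    obtain rfl : c = 1 := by omega
    omega
  have hK' : ∀ v w : Fin n, v ≠ w → ((v : ℕ) + w + 1 = p ∨ (v : ℕ) + w + 1 = n + p) →
      m v + m w = n := by
    intro v w hvw h
    have h1 : (n : ℤ) ∣ ((m v + m w : ℕ) : ℤ) := by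
      refine hcancel _ ?_
      have h2 := dvd_sub (dvd_add (hmv v) (hmv w)) hv₀
      have h3 := dvd_add h2 (dvd_refl (n : ℤ))
      rcases h with h | h
      · have h4 : (v : ℤ) + w + 1 = p := by exact_mod_cast h
        have h5 : (p : ℤ) * ((m v + m w : ℕ) : ℤ) =
            v₀ + p * m v - v + (v₀ + p * m w - w) - (2 * v₀ + 1 - p) := by
          push_cast
          linear_combination h4
        rwa [h5]
      · have h4 : (v : ℤ) + w + 1 = n + p := by exact_mod_cast h
        have h5 : (p : ℤ) * ((m v + m w : ℕ) : ℤ) =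
            v₀ + p * m v - v + (v₀ + p * m w - w) - (2 * v₀ + 1 - p) + n := by
          push_cast
          linear_combination h4
        rwa [h5]
    obtain ⟨c, hc⟩ := Int.natCast_dvd_natCast.mp h1
    have := hm v
    have := hm w
    have : c < 2 := by
      by_contra! h2
      have := Nat.mul_le_mul_left n h2
      omega
    have : c ≠ 0 := by
      rintro rfl
      exact hvw (hminj v w (by omega))
    obtain rfl : c = 1 := by omega
    omega
  -- Alternating the two reflections visits `m = 0, n - 1, 1, n - 2, …`, and this is the rank in
  -- that list.
  refine ⟨fun v => if 2 * m v < n then 2 * m v else 2 * n - 1 - 2 * m v, ?_, ?_⟩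
  · intro v w h
    have := hm v
    have := hm w
    refine hminj v w ?_
    simp only at h
    split_ifs at h <;> omega
  · intro i j h
    have hne : i ≠ j := by
      rintro rfl
      simp only [MeanderEdge] at h
      omega
    have hmne : m i ≠ m j := fun h => hne (hminj i j h)
    have h1 : m i + m j + 1 = n ∨ m i + m j = n := by
      rcases h with ⟨-, h⟩ | ⟨-, h⟩ | ⟨-, -, h⟩
      · exact Or.inl (hK i j h)
      · exact Or.inr (hK' i j hne (Or.inl h))
      · exact Or.inr (hK' i j hne (Or.inr h))
    have := hm i
    have := hm j
    simp only
    split_ifs <;> omega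

/-- On an oriented graph contained in a path, there is a potential with prescribed increments along
the edges. -/
theorem exists_potential {V : Type*} [Nonempty V] {pos : V → ℕ} (hpos : Function.Injective pos)
    {E : V → V → Prop} (hE : ∀ i j, E i j → pos j = pos i + 1 ∨ pos i = pos j + 1)
    (hasymm : ∀ i j, E i j → ¬ E j i) (wt : V → V → ℤ) :
    ∃ H : V → ℤ, ∀ i j, E i j → H j = H i + wt i j := by
  classical
  let x := Function.invFun pos
  have hx : ∀ v, x (pos v) = v := Function.leftInverse_invFun hpos
  let g : ℕ → ℤ := fun s => if E (x s) (x (s + 1)) then wt (x s) (x (s + 1)) else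
    - wt (x (s + 1)) (x s)
  refine ⟨fun v => ∑ s ∈ Finset.range (pos v), g s, fun i j hij => ?_⟩
  rcases hE i j hij with h | h
  · have hj : x (pos i + 1) = j := by rw [← h, hx]
    simp only [h, Finset.sum_range_succ, g, hj, hx, hij, if_true]
  · have hi : x (pos j + 1) = i := by rw [← h, hx]
    simp only [h, Finset.sum_range_succ, g, hi, hx, hasymm i j hij, if_false]
    ring

theorem MeanderEdge.asymm (hp : 1 ≤ p) (hpn : p < n) {i j : Fin n} (h : MeanderEdge n p i j) :
    ¬ MeanderEdge n p j i := by
  simp only [MeanderEdge] at h ⊢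
  omega

/-- The total order `e` increases along the non-simple edges of the meander graph, and two
successive vertices are joined by such an edge or go from the second block to the first. -/
structure IsAdapted (p : ℕ) (e : Equiv.Perm (Fin n)) : Prop where
  lt : ∀ i j, MeanderEdge n p i j → ¬ IsSimpleUpToSign (i, j) → e.symm i < e.symm j
  succ : ∀ s t : Fin n, (s : ℕ) + 1 = t →
    (MeanderEdge n p (e s) (e t) ∧ ¬ IsSimpleUpToSign (e s, e t)) ∨
      (p ≤ (e s : ℕ) ∧ (e t : ℕ) < p)

theorem exists_perm_strictMono {α : Type*} [LinearOrder α] {key : Fin n → α}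
    (hkey : Function.Injective key) :
    ∃ e : Equiv.Perm (Fin n), StrictMono (key ∘ e) :=
  ⟨Tuple.sort key, (Tuple.monotone_sort key).strictMono_of_injective
    (hkey.comp (Equiv.injective _))⟩

/-- The kept arrows form chains `v → n - 1 - v → v + p → …` moving towards the centre, one for each
starting point `v < p`. The chains are stacked so that all the other arrows increase too. -/
theorem exists_isAdapted_of_two_mul_lt (hp : 2 ≤ p) (hpn : 2 * p < n) (hcop : Nat.Coprime p n) :
    ∃ e : Equiv.Perm (Fin n), IsAdapted p e ∧
      ∀ i j, MeanderEdge n p i j → e.symm i < e.symm j := by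
  classical
  have hpar := not_even_and_even hcop
  have hne : Nonempty (Fin n) := ⟨⟨0, by omega⟩⟩
  let Kept : Fin n → Fin n → Prop := fun i j =>
    (2 * (i : ℕ) ≤ n ∧ n < 2 * (j : ℕ) ∧ (i : ℕ) + j + 1 = n) ∨
      (n < 2 * (i : ℕ) ∧ 2 * (j : ℕ) ≤ n ∧ (i : ℕ) + j + 1 = n + p)
  have hKE : ∀ i j, Kept i j → MeanderEdge n p i j ∧ ¬ IsSimpleUpToSign (i, j) := by
    intro i j h
    simp only [Kept] at h
    simp only [MeanderEdge, IsSimpleUpToSign]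
    omega
  obtain ⟨pos, hpos, hadj⟩ := exists_path_numbering (by omega) (by omega) hcop
  -- The height `H` is constant on chains and rises by one along every other arrow, including the
  -- simple one.
  obtain ⟨H, hH⟩ := exists_potential hpos hadj
    (fun i j h => MeanderEdge.asymm (by omega) (by omega) h)
    (fun i j => if Kept i j then 0 else 1)
  have hHk : ∀ i j, Kept i j → H j = H i := by
    intro i j h
    rw [hH i j (hKE i j h).1, if_pos h, add_zero]
  -- The residue of `idx` modulo `p` names the chain and `ps` orders the vertices inside it.
  let idx : Fin n → ℕ := fun v => if 2 * (v : ℕ) ≤ n then v else n - 1 - v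
  let ps : Fin n → ℕ := fun v => if 2 * (v : ℕ) ≤ n then 2 * v else 2 * (n - 1 - v) + 1
  have hps : ∀ v w, ps v = ps w → v = w := by
    intro v w h
    have := v.2
    have := w.2
    refine Fin.ext ?_
    simp only [ps] at h
    split_ifs at h <;> omega
  have hpsk : ∀ i j, Kept i j → ps i < ps j ∧ idx i % p = idx j % p := by
    intro i j h
    have := i.2
    have := j.2
    rcases h with ⟨h1, h2, h3⟩ | ⟨h1, h2, h3⟩
    · have e1 : idx i = idx j := by simp only [idx]; split_ifs <;> omega
      refine ⟨by simp only [ps]; split_ifs <;> omega, by rw [e1]⟩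
    · have e1 : idx j = idx i + p := by simp only [idx]; split_ifs <;> omega
      refine ⟨by simp only [ps]; split_ifs <;> omega, by rw [e1, Nat.add_mod_right]⟩
  let key : Fin n → ℤ ×ₗ ℕ ×ₗ ℕ := fun v => toLex (H v, toLex (idx v % p, ps v))
  have hlt : ∀ v w, key v < key w ↔ H v < H w ∨ H v = H w ∧
      (idx v % p < idx w % p ∨ idx v % p = idx w % p ∧ ps v < ps w) := by
    intro v w
    simp [key, Prod.Lex.lt_iff]
  have hkey : Function.Injective key := by
    intro v w h
    simp only [key, EmbeddingLike.apply_eq_iff_eq, Prod.mk.injEq] at h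
    exact hps v w h.2.2
  have hkk : ∀ i j, Kept i j → key i < key j := fun i j h =>
    (hlt i j).mpr (Or.inr ⟨(hHk i j h).symm, Or.inr ⟨(hpsk i j h).2, (hpsk i j h).1⟩⟩)
  have hke : ∀ i j, MeanderEdge n p i j → key i < key j := by
    intro i j h
    by_cases hk : Kept i j
    · exact hkk i j hk
    · refine (hlt i j).mpr (Or.inl ?_)
      rw [hH i j h, if_neg hk]
      omega
  obtain ⟨e, he⟩ := exists_perm_strictMono hkey
  have hsymm : ∀ i j, key i < key j → e.symm i < e.symm j := by
    intro i j h
    rw [← he.lt_iff_lt]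
    simpa using h
  refine ⟨e, ⟨fun i j h _ => hsymm i j (hke i j h), fun s t hst => ?_⟩,
    fun i j h => hsymm i j (hke i j h)⟩
  have hvw : key (e s) < key (e t) := he (by rw [Fin.lt_def]; omega)
  have hbetween : ∀ u, key (e s) < key u → key u < key (e t) → False := by
    intro u h1 h2
    have h1' := hsymm _ _ h1
    have h2' := hsymm _ _ h2
    simp only [Equiv.symm_apply_apply, Fin.lt_def] at h1' h2'
    omega
  generalize e s = v at *
  generalize e t = w at *
  have hv := v.2
  have hw := w.2
  -- Within one chain, successive vertices are joined by a kept arrow: the kept successor of `v`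
  -- cannot lie strictly between `v` and `w`, and `idx` can only jump by multiples of `p`.
  by_cases hsame : H v = H w ∧ idx v % p = idx w % p
  · left
    obtain ⟨hHvw, hid⟩ := hsame
    have hpsvw : ps v < ps w := by
      rcases (hlt v w).mp hvw with h | ⟨-, h | h⟩
      · omega
      · omega
      · exact h.2
    have hmid : ∀ u, Kept v u → u ≠ w → ps w ≤ ps u := by
      intro u hu huw
      by_contra! hcon
      refine hbetween u (hkk v u hu) ((hlt u w).mpr (Or.inr ⟨?_, Or.inr ⟨?_, hcon⟩⟩))
      · rw [hHk v u hu, hHvw]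
      · rw [← (hpsk v u hu).2, hid]
    apply hKE
    have hgap : idx v < idx w → idx v + p ≤ idx w := by
      intro h
      obtain ⟨c, hc⟩ := (Nat.modEq_iff_dvd' h.le).mp hid
      have : c ≠ 0 := by rintro rfl; omega
      have := Nat.mul_le_mul_left p (Nat.one_le_iff_ne_zero.mpr this)
      omega
    by_cases hlow : 2 * (v : ℕ) ≤ n
    · by_cases hhigh : n < 2 * (n - 1 - (v : ℕ))
      · have hk : Kept v ⟨n - 1 - v, by omega⟩ := Or.inl ⟨hlow, hhigh, by simp only; omega⟩
        by_cases huw : (⟨n - 1 - v, by omega⟩ : Fin n) = w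
        · rwa [huw] at hk
        · exfalso
          have h1 := hmid _ hk huw
          refine huw (hps _ _ ?_)
          simp only [ps] at h1 hpsvw ⊢
          split_ifs at h1 hpsvw ⊢ <;> omega
      · exfalso
        simp only [ps, idx] at hpsvw hgap
        split_ifs at hpsvw hgap <;> omega
    · have hidx : idx v < idx w := by
        simp only [ps, idx] at hpsvw ⊢
        split_ifs at hpsvw ⊢ <;> omega
      have h2 := hgap hidx
      have h3 : 2 * (n - 1 - (v : ℕ) + p) ≤ n := by
        simp only [idx] at h2
        split_ifs at h2 <;> omega
      have hk : Kept v ⟨n - 1 - v + p, by omega⟩ :=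
        Or.inr ⟨by omega, h3, by simp only; omega⟩
      by_cases huw : (⟨n - 1 - v + p, by omega⟩ : Fin n) = w
      · rwa [huw] at hk
      · exfalso
        have h1 := hmid _ hk huw
        refine huw (hps _ _ ?_)
        simp only [ps, idx] at h1 h2 hpsvw ⊢
        split_ifs at h1 h2 hpsvw ⊢ <;> omega
  -- Here `v` ends its chain and `w` starts another. Every vertex below `p` has a kept successor and
  -- every vertex from `p` on has a kept predecessor, hence the two blocks.
  · right
    have hfar : ∀ u, H u = H v → idx u % p = idx v % p → key u < key w := by
      intro u h1 h2
      rw [hlt] at hvw ⊢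
      rw [h1, h2]
      rcases hvw with h | ⟨h, h' | h'⟩
      · exact Or.inl h
      · exact Or.inr ⟨h, Or.inl h'⟩
      · exact absurd ⟨h, h'.1⟩ hsame
    have hfar' : ∀ u, H u = H w → idx u % p = idx w % p → key v < key u := by
      intro u h1 h2
      rw [hlt] at hvw ⊢
      rw [h1, h2]
      rcases hvw with h | ⟨h, h' | h'⟩
      · exact Or.inl h
      · exact Or.inr ⟨h, Or.inl h'⟩
      · exact absurd ⟨h, h'.1⟩ hsame
    have hlast : ∀ u, ¬ Kept v u := fun u hu =>
      hbetween u (hkk v u hu) (hfar u (hHk v u hu) (hpsk v u hu).2.symm)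
    have hfirst : ∀ u, ¬ Kept u w := fun u hu =>
      hbetween u (hfar' u (hHk u w hu).symm (hpsk u w hu).2) (hkk u w hu)
    constructor
    · by_contra! hcon
      refine hlast ⟨n - 1 - v, by omega⟩ (Or.inl ⟨by omega, ?_, ?_⟩) <;> simp only <;> omega
    · by_contra! hcon
      by_cases hlow : 2 * (w : ℕ) ≤ n
      · refine hfirst ⟨n - 1 + p - w, by omega⟩ (Or.inr ⟨?_, hlow, ?_⟩) <;> simp only <;> omega
      · refine hfirst ⟨n - 1 - w, by omega⟩ (Or.inl ⟨?_, by omega, ?_⟩) <;> simp only <;> omega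

/-- Reversing the indices exchanges the block sizes and the direction of the arrows, which reduces
`2 * p > n` to `2 * p < n`. -/
theorem meanderEdge_rev (hpn : p < n) {i j : Fin n} :
    MeanderEdge n (n - p) i j ↔ MeanderEdge n p j.rev i.rev := by
  simp only [MeanderEdge, Fin.val_rev]
  omega

theorem isSimpleUpToSign_rev {i j : Fin n} :
    IsSimpleUpToSign (i, j) ↔ IsSimpleUpToSign (j.rev, i.rev) := by
  simp only [IsSimpleUpToSign, Fin.val_rev]
  omega

/-- The image of the opposite of the total order `e` under the reversal of the indices. -/
def dualOrder (e : Equiv.Perm (Fin n)) : Equiv.Perm (Fin n) :=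
  Fin.revPerm.trans (e.trans Fin.revPerm)

theorem dualOrder_apply (e : Equiv.Perm (Fin n)) (s : Fin n) : dualOrder e s = (e s.rev).rev := rfl

theorem dualOrder_symm_apply (e : Equiv.Perm (Fin n)) (i : Fin n) :
    (dualOrder e).symm i = (e.symm i.rev).rev := rfl

theorem IsAdapted.dual (hpn : p < n) {e : Equiv.Perm (Fin n)} (h : IsAdapted p e) :
    IsAdapted (n - p) (dualOrder e) where
  lt i j hij hs := by
    rw [dualOrder_symm_apply, dualOrder_symm_apply, Fin.rev_lt_rev]
    exact h.lt _ _ ((meanderEdge_rev hpn).mp hij) fun h' => hs (isSimpleUpToSign_rev.mpr h')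
  succ s t hst := by
    rw [meanderEdge_rev hpn, isSimpleUpToSign_rev, dualOrder_apply, dualOrder_apply, Fin.rev_rev,
      Fin.rev_rev, Fin.val_rev, Fin.val_rev]
    have h1 := h.succ t.rev s.rev (by rw [Fin.val_rev, Fin.val_rev]; omega)
    refine h1.imp_right fun h2 => ?_
    omega

theorem exists_isAdapted (hp : 2 ≤ p) (hpn : p + 2 ≤ n) (hcop : Nat.Coprime p n) :
    ∃ e : Equiv.Perm (Fin n), IsAdapted p e ∧
      ∀ i j, MeanderEdge n p i j → e.symm i < e.symm j := by
  rcases lt_trichotomy (2 * p) n with h | h | h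
  · exact exists_isAdapted_of_two_mul_lt hp h hcop
  · have := Nat.Coprime.eq_one_of_dvd hcop ⟨2, by omega⟩
    omega
  · obtain ⟨e, he, he'⟩ := exists_isAdapted_of_two_mul_lt (n := n) (p := n - p)
      (by omega) (by omega) ((Nat.coprime_self_sub_left (by omega)).mpr hcop)
    have hpp : n - (n - p) = p := by omega
    refine ⟨dualOrder e, hpp ▸ he.dual (by omega), fun i j hij => ?_⟩
    rw [dualOrder_symm_apply, dualOrder_symm_apply, Fin.rev_lt_rev]
    exact he' _ _ ((meanderEdge_rev (by omega)).mp (hpp.symm ▸ hij))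

/-- The total order `e` lists the vertices of the meander graph along an oriented path. -/
structure IsOrientedPath (p : ℕ) (e : Equiv.Perm (Fin n)) : Prop where
  succ_of_edge : ∀ i j, MeanderEdge n p i j → (e.symm i : ℕ) + 1 = e.symm j
  edge_of_succ : ∀ s t : Fin n, (s : ℕ) + 1 = t → MeanderEdge n p (e s) (e t)

theorem IsOrientedPath.dual (hpn : p < n) {e : Equiv.Perm (Fin n)} (h : IsOrientedPath p e) :
    IsOrientedPath (n - p) (dualOrder e) where
  succ_of_edge i j hij := by
    have h1 := h.succ_of_edge _ _ ((meanderEdge_rev hpn).mp hij)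
    rw [dualOrder_symm_apply, dualOrder_symm_apply, Fin.val_rev, Fin.val_rev]
    omega
  edge_of_succ s t hst := by
    rw [meanderEdge_rev hpn, dualOrder_apply, dualOrder_apply, Fin.rev_rev, Fin.rev_rev]
    exact h.edge_of_succ _ _ (by rw [Fin.val_rev, Fin.val_rev]; omega)

/-- For `p = 1` the first block has no arrow and the graph is the oriented path `0 → n - 1 → 1 → n -
2 → …`, whose last arrow is the simple one. -/
theorem exists_isOrientedPath_one (hn : 2 ≤ n) :
    ∃ e e' : Equiv.Perm (Fin n), IsOrientedPath 1 e ∧ IsAdapted 1 e' := by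
  let pos : Fin n → Fin n := fun v => ⟨if 2 * (v : ℕ) < n then 2 * v else 2 * (n - 1 - v) + 1, by
    split_ifs <;> omega⟩
  have hval : ∀ v, (pos v : ℕ) = if 2 * (v : ℕ) < n then 2 * (v : ℕ) else 2 * (n - 1 - v) + 1 :=
    fun v => rfl
  have hinj : Function.Injective pos := by
    intro v w h
    have h1 := congrArg Fin.val h
    have := v.2
    have := w.2
    rw [hval, hval] at h1
    refine Fin.ext ?_
    split_ifs at h1 <;> omega
  let e : Equiv.Perm (Fin n) :=
    (Equiv.ofBijective pos (Finite.injective_iff_bijective.mp hinj)).symm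
  have hsymm : ∀ v, e.symm v = pos v := fun v => rfl
  have hpe : ∀ s, pos (e s) = s := fun s => by rw [← hsymm, Equiv.symm_apply_apply]
  have hedge : ∀ i j, MeanderEdge n 1 i j ↔ (pos i : ℕ) + 1 = pos j := by
    intro i j
    have := i.2
    have := j.2
    rw [hval, hval]
    simp only [MeanderEdge]
    split_ifs <;> omega
  have hsimple : ∀ i j, MeanderEdge n 1 i j →
      (IsSimpleUpToSign (i, j) ↔ (pos j : ℕ) + 1 = n) := by
    intro i j h
    have := i.2
    have := j.2
    rw [hval]
    simp only [MeanderEdge, IsSimpleUpToSign] at h ⊢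
    split_ifs <;> omega
  -- Only the simple arrow enters the last vertex. Moving that vertex to the front keeps the other
  -- arrows increasing and makes it precede `0`, the sole element of the first block.
  let e' : Equiv.Perm (Fin n) := (finRotate n).symm.trans e
  have hsymm' : ∀ v, e'.symm v = finRotate n (pos v) := fun v => rfl
  have hrot : ∀ s : Fin n, (finRotate n s : ℕ) = if (s : ℕ) + 1 = n then 0 else (s : ℕ) + 1 := by
    intro s
    obtain ⟨m, rfl⟩ : ∃ m, n = m + 1 := ⟨n - 1, by omega⟩
    rw [coe_finRotate]
    simp only [Fin.ext_iff, Fin.val_last]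
    split_ifs <;> omega
  refine ⟨e, e', ⟨fun i j h => (hedge i j).mp h, fun s t hst => ?_⟩, ⟨fun i j h hs => ?_,
    fun s t hst => ?_⟩⟩
  · rw [hedge, hpe, hpe, hst]
  · have h1 := (hedge i j).mp h
    rw [hsimple i j h] at hs
    rw [Fin.lt_def, hsymm', hsymm', hrot, hrot]
    have := (pos j).2
    split_ifs <;> omega
  · have h1 : (s : ℕ) = if (pos (e' s) : ℕ) + 1 = n then 0 else (pos (e' s) : ℕ) + 1 := by
      rw [← hrot, ← hsymm', Equiv.symm_apply_apply]
    have h2 : (t : ℕ) = if (pos (e' t) : ℕ) + 1 = n then 0 else (pos (e' t) : ℕ) + 1 := by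
      rw [← hrot, ← hsymm', Equiv.symm_apply_apply]
    by_cases h3 : (pos (e' s) : ℕ) + 1 = n
    · right
      have h4 : (pos (e' t) : ℕ) = 0 := by split_ifs at h1 h2 <;> omega
      rw [hval] at h3 h4
      have := (e' s).2
      have := (e' t).2
      constructor
      · split_ifs at h3 <;> omega
      · split_ifs at h4; omega
    · left
      have h4 : MeanderEdge n 1 (e' s) (e' t) := by
        rw [hedge]
        split_ifs at h1 h2 <;> omega
      refine ⟨h4, ?_⟩
      rw [hsimple _ _ h4]
      split_ifs at h2 <;> omega

theorem exists_isOrientedPath (hn : 2 ≤ n) (hp : p = 1 ∨ p = n - 1) :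
    ∃ e e' : Equiv.Perm (Fin n), IsOrientedPath p e ∧ IsAdapted p e' := by
  obtain ⟨e, e', h1, h2⟩ := exists_isOrientedPath_one hn
  rcases hp with rfl | rfl
  · exact ⟨e, e', h1, h2⟩
  · exact ⟨_, _, h1.dual (by omega), h2.dual (by omega)⟩

end Meander

/-! ### Lifting the Weierstrass section to the regular nullcone. -/

section Weierstrass

variable {k : Type*} [Field k] {n p : ℕ}

theorem MeanderEdge.ne {i j : Fin n} (h : MeanderEdge n p i j) : i ≠ j := by
  rintro rfl
  simp only [MeanderEdge] at h
  omega

theorem rootVector_val_apply {γ : Fin n × Fin n} (hγ : γ.1 ≠ γ.2) (i j : Fin n) :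
    (rootVector k γ).val i j = if (i, j) = γ then 1 else 0 := by
  rw [rootVector, dif_pos hγ, val_single, Matrix.single_apply]
  simp only [Prod.ext_iff, eq_comm]

theorem val_sum_apply {ι : Type*} (s : Finset ι) (x : ι → sl (Fin n) k) (i j : Fin n) :
    (∑ q ∈ s, x q).val i j = ∑ q ∈ s, (x q).val i j := by
  let φ : sl (Fin n) k →+ k :=
    { toFun := fun y => y.val i j
      map_zero' := rfl
      map_add' := fun _ _ => rfl }
  exact map_sum φ x s

open Classical in
theorem eta_val_apply (hp : 1 ≤ p) (hpn : p < n) (γ : Fin n × Fin n) (i j : Fin n) :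
    (eta k (simpleRoots n) (simpleRoots n \ {p}) γ).val i j =
      if MeanderEdge n p i j ∧ (i, j) ≠ γ then 1 else 0 := by
  rw [eta, val_sum_apply, Finset.sum_congr rfl fun δ hδ => rootVector_val_apply
    (((mem_cascadeRoots hp hpn).mp (Finset.mem_filter.mp hδ).2.1).ne) i j, Finset.sum_ite_eq]
  simp [mem_cascadeRoots hp hpn]

open Classical in
variable (k) in
/-- The sum of the matrix units from the second block to the first at two successive indices of the
total order `e`. -/
def link (p : ℕ) (e : Equiv.Perm (Fin n)) : sl (Fin n) k :=
  ⟨Matrix.of fun i j => if p ≤ (i : ℕ) ∧ (j : ℕ) < p ∧ (e.symm i : ℕ) + 1 = e.symm j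
    then 1 else 0, by
    change Matrix.trace (Matrix.of fun i j : Fin n => if p ≤ (i : ℕ) ∧ (j : ℕ) < p ∧
      (e.symm i : ℕ) + 1 = e.symm j then (1 : k) else 0) = 0
    refine Finset.sum_eq_zero fun i _ => ?_
    simp⟩

open Classical in
theorem link_val_apply (p : ℕ) (e : Equiv.Perm (Fin n)) (i j : Fin n) :
    (link k p e).val i j = if p ≤ (i : ℕ) ∧ (j : ℕ) < p ∧ (e.symm i : ℕ) + 1 = e.symm j
      then 1 else 0 := rfl

/-- The trace pairs the entry `(i, j)` of `y` with the entry `(j, i)` of an element of the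
parabolic, which is zero from the first block to the second. -/
theorem restriction_killingForm_eq_zero {y : sl (Fin n) k}
    (hy : ∀ i j, y.val i j ≠ 0 → p ≤ (i : ℕ) ∧ (j : ℕ) < p) :
    restriction k n (simpleRoots n) (simpleRoots n \ {p}) (killingForm k (sl (Fin n) k) y) = 0 := by
  refine LinearMap.ext fun u => ?_
  change killingForm k (sl (Fin n) k) y u.1.1 = 0
  rw [killingForm_sl, Matrix.trace]
  refine mul_eq_zero_of_right _ (Finset.sum_eq_zero fun i _ => ?_)
  rw [Matrix.diag_apply, Matrix.mul_apply]
  refine Finset.sum_eq_zero fun j _ => ?_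
  by_cases h : y.val i j = 0
  · rw [h, zero_mul]
  · obtain ⟨h1, h2⟩ := hy i j h
    have h3 : u.1.1 ∈ negParabolic k n (simpleRoots n \ {p}) := u.1.2.1
    rw [h3 j i ?_, mul_zero]
    rintro (h4 | h4)
    · rw [Fin.le_def] at h4
      omega
    · exact (h4 p h2 h1).2 rfl

theorem lie_mem_truncation {a : Type*} [LieRing a] [LieAlgebra k a] (u v : a) :
    ⁅u, v⁆ ∈ truncation k a := by
  intro χ F h
  have h1 := adS_lie k a u v F
  simp only [h.2, Derivation.map_smul, smul_smul, mul_comm (χ v), sub_self] at h1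
  exact (smul_eq_zero.mp h1).resolve_right h.1

/-- The root vector opposed to a root of `𝒦 ∪ (-𝒦')` lies in the truncated biparabolic. -/
theorem exists_mem_truncatedBiparabolic [CharZero k] (hp : 1 ≤ p)
    {γ : Fin n × Fin n} (hγ : MeanderEdge n p γ.1 γ.2) :
    ∃ u : truncatedBiparabolic k n (simpleRoots n) (simpleRoots n \ {p}),
      u.1.1 = rootVector k (γ.2, γ.1) := by
  have hpos : ∀ x, x ∈ posParabolic k n (simpleRoots n) := by
    intro x i j hij
    refine absurd (Or.inr fun l h1 h2 => ?_) hij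
    simp only [simpleRoots, Set.mem_Ico]
    omega
  have hne : γ.2 ≠ γ.1 := hγ.ne.symm
  have hx : rootVector k (γ.2, γ.1) ∈ biparabolic k n (simpleRoots n) (simpleRoots n \ {p}) := by
    refine ⟨fun i j hij => ?_, hpos _⟩
    rw [rootVector_val_apply hne, if_neg]
    rintro h
    obtain ⟨rfl, rfl⟩ := Prod.mk.injEq _ _ _ _ ▸ h
    refine hij ?_
    rcases hγ with h | h | h
    · left
      rw [Fin.le_def]
      omega
    all_goals
      right
      intro l h1 h2
      simp only [simpleRoots, Set.mem_sdiff, Set.mem_Ico, Set.mem_singleton_iff]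
      have := γ.1.2
      omega
  have hh : singleSubSingle γ.2 γ.1 (1 : k) ∈
      biparabolic k n (simpleRoots n) (simpleRoots n \ {p}) := by
    refine ⟨fun i j hij => ?_, hpos _⟩
    rw [val_singleSubSingle, Matrix.sub_apply, Matrix.single_apply, Matrix.single_apply, if_neg,
      if_neg, sub_zero]
    all_goals
      rintro ⟨rfl, rfl⟩
      exact hij (Or.inl le_rfl)
  -- The root vector is half of a bracket inside the biparabolic, and weights of semi-invariants
  -- vanish on brackets.
  have hlie : ⁅singleSubSingle γ.2 γ.1 (1 : k), rootVector k (γ.2, γ.1)⁆ =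
      (2 : k) • rootVector k (γ.2, γ.1) := by
    apply Subtype.ext
    rw [sl_bracket, rootVector, dif_pos hne, val_singleSubSingle]
    change _ = (2 : k) • (single γ.2 γ.1 hne (1 : k)).val
    rw [val_single, sub_mul, mul_sub, Matrix.single_mul_single_same,
      Matrix.single_mul_single_of_ne _ _ _ _ hne.symm,
      Matrix.single_mul_single_of_ne _ _ _ _ hne.symm,
      Matrix.single_mul_single_same, two_smul]
    simp
  refine ⟨⟨⟨_, hx⟩, ?_⟩, rfl⟩
  have h1 := lie_mem_truncation (k := k)
    (⟨_, hh⟩ : biparabolic k n (simpleRoots n) (simpleRoots n \ {p})) ⟨_, hx⟩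
  have h2 : (⁅(⟨_, hh⟩ : biparabolic k n (simpleRoots n) (simpleRoots n \ {p})), ⟨_, hx⟩⁆ :
      biparabolic k n (simpleRoots n) (simpleRoots n \ {p})) = (2 : k) • ⟨_, hx⟩ :=
    Subtype.ext hlie
  rw [h2] at h1
  have h3 := (truncation k (biparabolic k n (simpleRoots n) (simpleRoots n \ {p}))).smul_mem
    (2 : k)⁻¹ h1
  rwa [smul_smul, inv_mul_cancel₀ two_ne_zero, one_smul] at h3

theorem killingForm_rootVector (x : sl (Fin n) k) {γ : Fin n × Fin n}
    (hγ : γ.1 ≠ γ.2) :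
    killingForm k (sl (Fin n) k) x (rootVector k (γ.2, γ.1)) = 2 * n * x.val γ.1 γ.2 := by
  have h : (rootVector k (γ.2, γ.1)).val = Matrix.single γ.2 γ.1 1 := by
    rw [rootVector, dif_pos hγ.symm, val_single]
  rw [killingForm_sl, h, Matrix.trace_mul_single, MulOpposite.op_one, one_smul]

theorem eta_add_link_succ_ne_zero (hp : 1 ≤ p) (hpn : p < n) {γ : Fin n × Fin n}
    (hγ : MeanderEdge n p γ.1 γ.2) (hs : IsSimpleUpToSign γ) {e : Equiv.Perm (Fin n)}
    (he : IsAdapted p e) (c : k) (s t : Fin n) (hst : (s : ℕ) + 1 = t) :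
    (eta k (simpleRoots n) (simpleRoots n \ {p}) γ + link k p e + c • rootVector k γ).val
      (e s) (e t) ≠ 0 := by
  rw [val_add_apply, val_add_apply, val_smul_apply, eta_val_apply hp hpn, link_val_apply,
    rootVector_val_apply hγ.ne]
  have hsucc : (e.symm (e s) : ℕ) + 1 = e.symm (e t) := by simpa using hst
  rcases he.succ s t hst with ⟨h1, h2⟩ | h1
  · have h3 : (e s, e t) ≠ γ := by rintro rfl; exact h2 hs
    have h4 : ¬ (p ≤ (e s : ℕ) ∧ (e t : ℕ) < p ∧ (e.symm (e s) : ℕ) + 1 = e.symm (e t)) := by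
      simp only [MeanderEdge] at h1
      omega
    rw [if_pos ⟨h1, h3⟩, if_neg h4, if_neg h3]
    simp
  · have h3 : ¬ MeanderEdge n p (e s) (e t) := by
      simp only [MeanderEdge]
      omega
    have h4 : (e s, e t) ≠ γ := by rintro rfl; exact h3 hγ
    rw [if_neg fun h => h3 h.1, if_pos ⟨h1.1, h1.2, hsucc⟩, if_neg h4]
    simp

theorem isTriangularFor_eta_add_link (hp : 1 ≤ p) (hpn : p < n) {γ : Fin n × Fin n}
    (huniq : ∀ δ : Fin n × Fin n, MeanderEdge n p δ.1 δ.2 → IsSimpleUpToSign δ → δ = γ)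
    {e : Equiv.Perm (Fin n)} (he : IsAdapted p e) :
    IsTriangularFor e (eta k (simpleRoots n) (simpleRoots n \ {p}) γ + link k p e).val := by
  intro i j h
  rw [val_add_apply, eta_val_apply hp hpn, link_val_apply] at h
  by_cases h1 : MeanderEdge n p i j ∧ (i, j) ≠ γ
  · exact he.lt i j h1.1 fun h2 => h1.2 (huniq _ h1.1 h2)
  · rw [if_neg h1, zero_add] at h
    have h2 := (ite_ne_right_iff.mp h).1
    rw [Fin.lt_def]
    omega

variable [CharZero k]

/-- The parametrization of the Weierstrass section is injective. -/
theorem weierstrass_injective (hp : 1 ≤ p) (hpn : p < n) {γ : Fin n × Fin n}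
    (hγ : MeanderEdge n p γ.1 γ.2) :
    Function.Injective fun c : k =>
      restriction k n (simpleRoots n) (simpleRoots n \ {p}) (killingForm k (sl (Fin n) k)
        (eta k (simpleRoots n) (simpleRoots n \ {p}) γ + c • rootVector k γ)) := by
  intro c d h
  obtain ⟨u, hu⟩ := exists_mem_truncatedBiparabolic (k := k) hp hγ
  have h1 : ∀ c : k, restriction k n (simpleRoots n) (simpleRoots n \ {p})
      (killingForm k (sl (Fin n) k)
        (eta k (simpleRoots n) (simpleRoots n \ {p}) γ + c • rootVector k γ)) u = 2 * n * c := by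
    intro c
    change killingForm k (sl (Fin n) k) _ u.1.1 = _
    rw [hu, killingForm_rootVector _ hγ.ne, val_add_apply, val_smul_apply, eta_val_apply hp hpn,
      rootVector_val_apply hγ.ne]
    simp
  have h2 := LinearMap.congr_fun h u
  simp only [h1] at h2
  have hn : (2 * n : k) ≠ 0 := mul_ne_zero two_ne_zero (Nat.cast_ne_zero.mpr (by omega))
  exact mul_left_cancel₀ hn h2

/-- A family of matrices that agrees with the parametrization of the Weierstrass section modulo the
matrix units from the second block to the first is mapped bijectively onto it. -/
theorem bijOn_weierstrassLine (hp : 1 ≤ p) (hpn : p < n) {γ : Fin n × Fin n}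
    (hγ : MeanderEdge n p γ.1 γ.2) {X : k → sl (Fin n) k}
    (hX : ∀ c i j, (X c - (eta k (simpleRoots n) (simpleRoots n \ {p}) γ +
      c • rootVector k γ)).val i j ≠ 0 → p ≤ (i : ℕ) ∧ (j : ℕ) < p) :
    Set.BijOn (restriction k n (simpleRoots n) (simpleRoots n \ {p}))
      (Set.range fun c => killingForm k (sl (Fin n) k) (X c))
      (weierstrassLine k (simpleRoots n) (simpleRoots n \ {p}) γ) := by
  have h1 : ∀ c, restriction k n (simpleRoots n) (simpleRoots n \ {p})
      (killingForm k (sl (Fin n) k) (X c)) =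
      restriction k n (simpleRoots n) (simpleRoots n \ {p}) (killingForm k (sl (Fin n) k)
        (eta k (simpleRoots n) (simpleRoots n \ {p}) γ + c • rootVector k γ)) := by
    intro c
    rw [← sub_eq_zero, ← map_sub, ← map_sub]
    exact restriction_killingForm_eq_zero (hX c)
  refine ⟨?_, ?_, ?_⟩
  · rintro _ ⟨c, rfl⟩
    exact ⟨c, (h1 c).symm⟩
  · rintro _ ⟨c, rfl⟩ _ ⟨d, rfl⟩ h
    simp only [h1] at h
    rw [weierstrass_injective hp hpn hγ h]
  · rintro _ ⟨c, rfl⟩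
    exact ⟨_, ⟨c, rfl⟩, h1 c⟩

theorem killingForm_rootVector_ne_zero {γ : Fin n × Fin n}
    (hγ : MeanderEdge n p γ.1 γ.2) : killingForm k (sl (Fin n) k) (rootVector k γ) ≠ 0 := by
  intro h
  have h1 := LinearMap.congr_fun h (rootVector k (γ.2, γ.1))
  rw [killingForm_rootVector _ hγ.ne, rootVector_val_apply hγ.ne, if_pos rfl, mul_one,
    LinearMap.zero_apply] at h1
  exact mul_ne_zero two_ne_zero (Nat.cast_ne_zero.mpr γ.1.pos.ne') h1

variable [IsAlgClosed k]

/-- The family over the Weierstrass section when neither block has size one. -/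
theorem exists_line_over_weierstrass (hp : 2 ≤ p) (hpn : p + 2 ≤ n) (hcop : Nat.Coprime p n)
    {γ : Fin n × Fin n} (hγ : MeanderEdge n p γ.1 γ.2) (hs : IsSimpleUpToSign γ)
    (huniq : ∀ δ : Fin n × Fin n, MeanderEdge n p δ.1 δ.2 → IsSimpleUpToSign δ → δ = γ) :
    ∃ Z : Set (Module.Dual k (sl (Fin n) k)),
      IsSubvariety k _ (regNullcone k _) Z ∧ dimension k _ Z = 1 ∧
      Set.BijOn (restriction k n (simpleRoots n) (simpleRoots n \ {p})) Z
        (weierstrassLine k (simpleRoots n) (simpleRoots n \ {p}) γ) ∧ IsIrred k _ Z := by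
  obtain ⟨e, he, hlt⟩ := exists_isAdapted hp hpn hcop
  set η := eta k (simpleRoots n) (simpleRoots n \ {p}) γ with hη
  set f := killingForm k (sl (Fin n) k) (η + link k p e)
  set g := killingForm k (sl (Fin n) k) (rootVector k γ)
  have hfg : (fun c : k => f + c • g) =
      fun c => killingForm k (sl (Fin n) k) (η + link k p e + c • rootVector k γ) := by
    funext c
    rw [map_add _ (η + link k p e), map_smul]
  have hmem : ∀ c : k, f + c • g ∈ regNullcone k (sl (Fin n) k) := by
    intro c
    rw [congrFun hfg c]
    refine IsTriangularFor.mem_regNullcone (e := e) (fun i j h => ?_)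
      (eta_add_link_succ_ne_zero (by omega) (by omega) hγ hs he c)
    rw [val_add_apply, val_smul_apply] at h
    by_cases hij : (i, j) = γ
    -- The order makes `γ` increase as well, so triangularity holds for every `c`.
    · subst hij
      exact hlt i j hγ
    · rw [rootVector_val_apply hγ.ne, if_neg hij, mul_zero, add_zero] at h
      exact isTriangularFor_eta_add_link (by omega) (by omega) huniq he i j h
  refine ⟨Set.range fun c : k => f + c • g, ⟨_, isClosed_line f g, ?_⟩, ?_, ?_, ?_⟩
  · rw [eq_comm, Set.inter_eq_left]
    rintro _ ⟨c, rfl⟩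
    exact hmem c
  · rw [← Set.image_univ, ← Set.union_empty ((fun c : k => f + c • g) '' Set.univ)]
    exact dimension_line_union f g (killingForm_rootVector_ne_zero hγ) Set.infinite_univ
      Set.finite_empty (fun z hz => absurd hz (Set.notMem_empty z))
  · rw [hfg]
    refine bijOn_weierstrassLine (by omega) (by omega) hγ fun c i j h => ?_
    rw [← hη, show η + link k p e + c • rootVector k γ - (η + c • rootVector k γ) = link k p e by
      abel, link_val_apply] at h
    have := (ite_ne_right_iff.mp h).1
    exact ⟨this.1, this.2.1⟩
  · rw [← Set.image_univ]
    exact isIrred_line f g Set.infinite_univ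

/-- The family over the Weierstrass section when a block has size one. -/
theorem exists_line_union_point_over_weierstrass (hp : 1 ≤ p) (hpn : p < n)
    (hp' : p = 1 ∨ p = n - 1) {γ : Fin n × Fin n} (hγ : MeanderEdge n p γ.1 γ.2)
    (hs : IsSimpleUpToSign γ)
    (huniq : ∀ δ : Fin n × Fin n, MeanderEdge n p δ.1 δ.2 → IsSimpleUpToSign δ → δ = γ) :
    ∃ Z : Set (Module.Dual k (sl (Fin n) k)),
      IsSubvariety k _ (regNullcone k _) Z ∧ dimension k _ Z = 1 ∧
      Set.BijOn (restriction k n (simpleRoots n) (simpleRoots n \ {p})) Z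
        (weierstrassLine k (simpleRoots n) (simpleRoots n \ {p}) γ) ∧
      ∃ (C : Set (Module.Dual k (sl (Fin n) k))) (z : Module.Dual k (sl (Fin n) k)),
        IsSubvariety k _ (regNullcone k _) C ∧ IsIrred k _ C ∧ dimension k _ C = 1 ∧
        z ∉ C ∧ Z = C ∪ {z} := by
  classical
  obtain ⟨e, e', he, he'⟩ := exists_isOrientedPath (by omega) hp'
  set η := eta k (simpleRoots n) (simpleRoots n \ {p}) γ with hη
  set f := killingForm k (sl (Fin n) k) η
  set g := killingForm k (sl (Fin n) k) (rootVector k γ)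
  set z := killingForm k (sl (Fin n) k) (η + link k p e')
  have hg0 : g ≠ 0 := killingForm_rootVector_ne_zero hγ
  have hfg : ∀ c : k, f + c • g = killingForm k (sl (Fin n) k) (η + c • rootVector k γ) := by
    intro c
    rw [map_add, map_smul]
  have htri' := isTriangularFor_eta_add_link (k := k) hp hpn huniq he'
  have hsucc' : ∀ s t : Fin n, (s : ℕ) + 1 = t → (η + link k p e').val (e' s) (e' t) ≠ 0 := by
    intro s t hst
    have := eta_add_link_succ_ne_zero (k := k) hp hpn hγ hs he' 0 s t hst
    rwa [zero_smul, add_zero] at this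
  have hz : z ∈ regNullcone k (sl (Fin n) k) := htri'.mem_regNullcone hsucc'
  have htri : ∀ c : k, IsTriangularFor e (η + c • rootVector k γ).val := by
    intro c i j h
    have hij : MeanderEdge n p i j := by
      by_contra h'
      have h'' : (i, j) ≠ γ := by rintro rfl; exact h' hγ
      refine h ?_
      rw [val_add_apply, val_smul_apply, eta_val_apply hp hpn, rootVector_val_apply hγ.ne,
        if_neg h'', if_neg fun h => h' h.1, mul_zero, add_zero]
    have := he.succ_of_edge i j hij
    rw [Fin.lt_def]
    omega
  have hmem : ∀ c : k, c ≠ 0 → f + c • g ∈ regNullcone k (sl (Fin n) k) := by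
    intro c hc
    rw [hfg c]
    refine (htri c).mem_regNullcone fun s t hst => ?_
    have h := he.edge_of_succ s t hst
    rw [val_add_apply, val_smul_apply, eta_val_apply hp hpn, rootVector_val_apply hγ.ne]
    by_cases hst' : (e s, e t) = γ
    · simp [hst', hc]
    · simp [hst', h]
  have hη0 : f ∉ regNullcone k (sl (Fin n) k) := by
    have h0 : IsTriangularFor e η.val := by
      have := htri 0
      rwa [zero_smul, add_zero] at this
    -- The ends of `γ` are successive for `e`, and without `x_γ` the entry there is zero.
    refine h0.notMem_regNullcone (he.succ_of_edge _ _ hγ) ?_ htri' hsucc'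
    rw [Equiv.apply_symm_apply, Equiv.apply_symm_apply, eta_val_apply hp hpn]
    simp
  have hmem_iff : ∀ c : k, f + c • g ∈ regNullcone k (sl (Fin n) k) ↔ c ≠ 0 := by
    refine fun c => ⟨?_, hmem c⟩
    rintro h rfl
    rw [zero_smul, add_zero] at h
    exact hη0 h
  -- The link has no entry at `γ`, so an equality would force `c = 0`, where the point of the line
  -- is not regular.
  have hzline : ∀ c : k, f + c • g ≠ z := by
    intro c h
    have hc : c ≠ 0 := (hmem_iff c).mp (h ▸ hz)
    rw [hfg c] at h
    have h1 := killingForm_sl_injective (by omega) h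
    have h2 := add_left_cancel h1
    have h3 : (c • rootVector k γ).val γ.1 γ.2 = (link k p e').val γ.1 γ.2 := by rw [h2]
    have h4 : ¬ (p ≤ (γ.1 : ℕ) ∧ (γ.2 : ℕ) < p ∧ (e'.symm γ.1 : ℕ) + 1 = e'.symm γ.2) := by
      simp only [MeanderEdge] at hγ
      omega
    rw [val_smul_apply, rootVector_val_apply hγ.ne, if_pos rfl, link_val_apply, if_neg h4,
      mul_one] at h3
    exact hc h3
  let S : Set k := {c | c ≠ 0}
  have hS : S.Infinite := (Set.finite_singleton (0 : k)).infinite_compl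
  set C := (fun c : k => f + c • g) '' S
  have hCeq : C = (Set.range fun c : k => f + c • g) ∩ regNullcone k (sl (Fin n) k) := by
    ext y
    constructor
    · rintro ⟨c, hc, rfl⟩
      exact ⟨⟨c, rfl⟩, hmem c hc⟩
    · rintro ⟨⟨c, rfl⟩, hc⟩
      exact ⟨c, (hmem_iff c).mp hc, rfl⟩
  have := t1Space_zariski (k := k) (a := sl (Fin n) k)
  refine ⟨C ∪ {z}, ⟨(Set.range fun c : k => f + c • g) ∪ {z}, ?_, ?_⟩, ?_, ?_, C, z,
    ⟨_, isClosed_line f g, hCeq⟩, isIrred_line f g hS, ?_, ?_, rfl⟩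
  · let _ := zariski k (sl (Fin n) k)
    exact (isClosed_line f g).union isClosed_singleton
  · rw [Set.union_inter_distrib_right, ← hCeq, Set.inter_eq_left.mpr]
    rintro _ rfl
    exact hz
  · refine dimension_line_union f g hg0 hS (Set.finite_singleton z) ?_
    rintro _ rfl c
    exact hzline c
  -- The parametrization replaces the non-regular point over `c = 0` by `z`, which has the same
  -- restriction.
  · let X : k → sl (Fin n) k := fun c =>
      if c = 0 then η + link k p e' else η + c • rootVector k γ
    have hrange : C ∪ {z} = Set.range fun c => killingForm k (sl (Fin n) k) (X c) := by
      ext y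
      constructor
      · rintro (⟨c, hc, rfl⟩ | rfl)
        · refine ⟨c, ?_⟩
          simp only [X]
          rw [if_neg hc, ← hfg]
        · refine ⟨0, ?_⟩
          simp only [X, if_true]
          rfl
      · rintro ⟨c, rfl⟩
        by_cases hc : c = 0
        · right
          simp only [X]
          rw [if_pos hc]
          rfl
        · left
          refine ⟨c, hc, ?_⟩
          simp only [X]
          rw [if_neg hc, ← hfg]
    rw [hrange]
    refine bijOn_weierstrassLine hp hpn hγ fun c i j h => ?_
    by_cases hc : c = 0
    · simp only [X] at h
      rw [if_pos hc, ← hη, hc, zero_smul, add_zero, add_sub_cancel_left, link_val_apply] at h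
      have := (ite_ne_right_iff.mp h).1
      exact ⟨this.1, this.2.1⟩
    · simp only [X] at h
      rw [if_neg hc, ← hη, sub_self] at h
      exact absurd rfl h
  · rw [← Set.union_empty C]
    exact dimension_line_union f g hg0 hS Set.finite_empty
      (fun z hz => absurd hz (Set.notMem_empty z))
  · rintro ⟨c, -, h⟩
    exact hzline c h

end Weierstrass

end IndexOne

end

/-! ### The theorem, by cases on whether a block has size one. -/

theorem lemma10p2 (k : Type*) [Field k] [IsAlgClosed k] [CharZero k] (n p : ℕ)
    (hp : 1 ≤ p) (hpn : p < n) (hcop : Nat.Coprime p n) (πp πm : Set ℕ)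
    (hπp : πp = IndexOne.simpleRoots n) (hπm : πm = IndexOne.simpleRoots n \ {p}) :
    (∃! γ : Fin n × Fin n, IndexOne.IsExceptional πp πm γ) ∧
    ∀ γ : Fin n × Fin n, IndexOne.IsExceptional πp πm γ →
      ∃ Z : Set (Module.Dual k (LieAlgebra.SpecialLinear.sl (Fin n) k)),
        IndexOne.IsSubvariety k _ (IndexOne.regNullcone k _) Z ∧
        IndexOne.dimension k _ Z = 1 ∧
        Set.BijOn (IndexOne.restriction k n πp πm) Z (IndexOne.weierstrassLine k πp πm γ) ∧
        (p ≠ 1 ∧ p ≠ n - 1 → IndexOne.IsIrred k _ Z) ∧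
        (p = 1 ∨ p = n - 1 →
          ∃ (C : Set (Module.Dual k (LieAlgebra.SpecialLinear.sl (Fin n) k)))
            (z : Module.Dual k (LieAlgebra.SpecialLinear.sl (Fin n) k)),
            IndexOne.IsSubvariety k _ (IndexOne.regNullcone k _) C ∧
            IndexOne.IsIrred k _ C ∧ IndexOne.dimension k _ C = 1 ∧
            z ∉ C ∧ Z = C ∪ {z}) := by
  subst hπp hπm
  have hex : ∀ γ : Fin n × Fin n, IndexOne.IsExceptional (IndexOne.simpleRoots n)
      (IndexOne.simpleRoots n \ {p}) γ ↔
      IndexOne.MeanderEdge n p γ.1 γ.2 ∧ IndexOne.IsSimpleUpToSign γ := fun γ => by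
    rw [IndexOne.IsExceptional, IndexOne.mem_cascadeRoots hp hpn]
  simp only [hex]
  have huniq := IndexOne.existsUnique_simple_meanderEdge hp hpn hcop
  refine ⟨huniq, fun γ hγ => ?_⟩
  have hu : ∀ δ : Fin n × Fin n, IndexOne.MeanderEdge n p δ.1 δ.2 →
      IndexOne.IsSimpleUpToSign δ → δ = γ := fun δ h1 h2 => huniq.unique ⟨h1, h2⟩ hγ
  by_cases hp' : p = 1 ∨ p = n - 1
  · obtain ⟨Z, h1, h2, h3, h4⟩ :=
      IndexOne.exists_line_union_point_over_weierstrass (k := k) hp hpn hp' hγ.1 hγ.2 hu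
    exact ⟨Z, h1, h2, h3, fun h => absurd hp' (not_or.mpr h), fun _ => h4⟩
  · obtain ⟨Z, h1, h2, h3, h4⟩ := IndexOne.exists_line_over_weierstrass (k := k)
      (by omega) (by omega) hcop hγ.1 hγ.2 hu
    exact ⟨Z, h1, h2, h3, fun _ => h4, fun h => absurd h hp'⟩
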